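/- Let $H_n(0)$ be the $0$-Hecke algebra over $\mathbb C$: generators $T_1,\dots,T_{n-1}$, the braid relations, and $T_i^2=-T_i$. Let $\mathbf{Sym}=\mathbb C\langle S_1,S_2,\dots\rangle$ be the algebra of noncommutative symmetric functions ($S_0=1$, $\deg S_n=n$). For a composition $I=(i_1,\dots,i_s)$ of $n$ put $S^I=S_{i_1}\cdots S_{i_s}$ and $R_I=\sum_{J}(-1)^{\ell(I)-\ell(J)}S^J$, where $J$ runs over the compositions of $n$ that are coarser than or equal to $I$. Let $\varphi_I$ be the one-dimensional right $H_n(0)$-module on which $T_i$ acts by $-1$ if $i$ is a proper partial sum $i_1+\dots+i_j$ ($1\le j<s$) of $I$ and by $0$ otherwise, and let $P_I$ be its projective cover. The noncommutative characteristic of a finitely generated projective right $H_n(0)$-module is $\mathbf{ch}\big(\bigoplus_j P_{I_j}\big)=\sum_j R_{I_j}$. For integers $k,l\ge 0$ and $n\ge 0$, let $\mathrm{PF}^{(k,l)}_n$ be the set of words $a=a_1\cdots a_n$ over $\{1,\dots,l+(n-1)k\}$ whose nondecreasing rearrangement $a'_1\le\dots\le a'_n$ satisfies $a'_i\le l+(i-1)k$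 for all $i$ (so that for $n=0$ it consists of the empty word). Let $H_n(0)$ act on the right on the vector space with basis $\mathrm{PF}^{(k,l)}_n$ as follows: $a\cdot T_i$ is the word obtained from $a$ by exchanging $a_i$ and $a_{i+1}$ if $a_i<a_{i+1}$; it is $0$ if $a_i=a_{i+1}$; and it is $-a$ if $a_i>a_{i+1}$. With a central variable $t$ recording the degree, put $\sigma_t(A)=\sum_{n\ge0}S_nt^n\in\mathbf{Sym}[[t]]$; for $m\in\mathbb Z$ define $S_n(mA)$ by $\sum_{n\ge 0}S_n(mA)\,t^n=\sigma_t(A)^m$, and for $r\in\mathbb Z$ put $F(r,k)=\sum_{n\ge0}S_n((nk+r)A)\,t^n$. Then $g^{(k,l)}(A)=F(r,k)\,F(r-l,k)^{-1}$ does not depend on $r\in\mathbb Z$, and for every $n\ge0$ the above permutational $H_n(0)$-module on $\mathrm{PF}^{(k,l)}_n$ is projective, and its noncommutative characteristic is (well defined and equal to) the term of degree $n$ of $g^{(k,l)}(A)$, that is, the coefficient of $t^n$. -/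

import Mathlib

noncomputable section

namespace NCParking

open PowerSeries

/-! ### The 0-Hecke algebra and its simple right modules -/

/-- The defining relations of `H_n(0)`: the generators are `T_1, …, T_{n-1}`, and the generator
with index `i : Fin (n - 1)` is `T_{i+1}`. The relation `(T_i + 1) (T_i - q) = 0` reads
`T_i ^ 2 = - T_i` at `q = 0`. -/
inductive HeckeRel (n : ℕ) :
    FreeAlgebra ℂ (Fin (n - 1)) → FreeAlgebra ℂ (Fin (n - 1)) → Prop
  | quad (i : Fin (n - 1)) :
      HeckeRel n (FreeAlgebra.ι ℂ i * FreeAlgebra.ι ℂ i) (-FreeAlgebra.ι ℂ i)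
  | comm (i j : Fin (n - 1)) (h : (i : ℕ) + 1 < j) :
      HeckeRel n (FreeAlgebra.ι ℂ i * FreeAlgebra.ι ℂ j) (FreeAlgebra.ι ℂ j * FreeAlgebra.ι ℂ i)
  | braid (i j : Fin (n - 1)) (h : (i : ℕ) + 1 = j) :
      HeckeRel n (FreeAlgebra.ι ℂ i * FreeAlgebra.ι ℂ j * FreeAlgebra.ι ℂ i)
        (FreeAlgebra.ι ℂ j * FreeAlgebra.ι ℂ i * FreeAlgebra.ι ℂ j)

/-- The 0-Hecke algebra `H_n(0)`. Right `H_n(0)`-modules are modules over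
`(HeckeZero n)ᵐᵒᵖ`. -/
abbrev HeckeZero (n : ℕ) : Type := RingQuot (HeckeRel n)

/-- The generators of `H_n(0)`. -/
def heckeT {n : ℕ} (i : Fin (n - 1)) : HeckeZero n :=
  RingQuot.mkAlgHom ℂ (HeckeRel n) (FreeAlgebra.ι ℂ i)

/-- `i + 1` (for `i : Fin (n - 1)`) is a descent of the composition `I`, that is, a proper partial
sum of the parts of `I`. -/
def IsDescent {n : ℕ} (I : Composition n) (i : Fin (n - 1)) : Prop :=
  (⟨(i : ℕ) + 1, by omega⟩ : Fin (n + 1)) ∈ I.boundaries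

open Classical in
/-- The value of the character `φ_I` on a generator. -/
def simpleVal {n : ℕ} (I : Composition n) (i : Fin (n - 1)) : ℂ :=
  if IsDescent I i then -1 else 0

theorem simpleVal_rel {n : ℕ} (I : Composition n) :
    ∀ ⦃x y : FreeAlgebra ℂ (Fin (n - 1))⦄, HeckeRel n x y →
      FreeAlgebra.lift ℂ (simpleVal I) x = FreeAlgebra.lift ℂ (simpleVal I) y := by
  intro x y h
  cases h with
  | quad i =>
    simp only [map_mul, map_neg, FreeAlgebra.lift_ι_apply, simpleVal]
    split_ifs <;> simp
  | comm i j h => simp only [map_mul]; ring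
  | braid i j h =>
    simp only [map_mul, FreeAlgebra.lift_ι_apply, simpleVal]
    split_ifs <;> simp

/-- The character `φ_I` of `H_n(0)`: `T_i ↦ -1` if `i` is a descent of `I`, and `T_i ↦ 0`
otherwise. -/
def simpleChar {n : ℕ} (I : Composition n) : HeckeZero n →ₐ[ℂ] ℂ :=
  RingQuot.liftAlgHom ℂ ⟨FreeAlgebra.lift ℂ (simpleVal I), simpleVal_rel I⟩

/-- The one-dimensional simple right `H_n(0)`-module attached to the composition `I`. -/
def SimpleModule {n : ℕ} (_I : Composition n) : Type := ℂ

instance {n : ℕ} (I : Composition n) : AddCommGroup (SimpleModule I) :=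
  inferInstanceAs (AddCommGroup ℂ)

instance {n : ℕ} (I : Composition n) : Module (HeckeZero n)ᵐᵒᵖ (SimpleModule I) :=
  Module.compHom ℂ
    ((simpleChar I).toRingHom.fromOpposite (fun _ _ => mul_comm _ _))

/-! ### The permutational module on a set of words -/

/-- The word `w · σ_i`, obtained by exchanging two consecutive letters. -/
def swapWord {n : ℕ} (i : Fin (n - 1)) (w : Fin n → ℕ) : Fin n → ℕ :=
  w ∘ Equiv.swap ⟨(i : ℕ), by omega⟩ ⟨(i : ℕ) + 1, by omega⟩

theorem swapWord_apply {n : ℕ} (i : Fin (n - 1)) (w : Fin n → ℕ) (m : ℕ) (hm : m < n) :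
    swapWord i w ⟨m, hm⟩ =
      if m = i then w ⟨(i : ℕ) + 1, by omega⟩
      else if m = (i : ℕ) + 1 then w ⟨(i : ℕ), by omega⟩ else w ⟨m, hm⟩ := by
  simp only [swapWord, Function.comp, Equiv.swap_apply_def, Fin.mk.injEq]
  split_ifs <;> rfl

/-- A set of words of length `n` is permutational if it is stable under exchanging consecutive
letters (hence under `𝔖_n`). -/
def SwapStable {n : ℕ} (X : Set (Fin n → ℕ)) : Prop :=
  ∀ (i : Fin (n - 1)), ∀ w ∈ X, swapWord i w ∈ X

/-- `w · T_i` for a word `w = a_1 ⋯ a_n`: it is `w · σ_i` if `a_i < a_{i+1}`, it is `0` if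
`a_i = a_{i+1}`, and it is `-w` if `a_i > a_{i+1}`. -/
def wordAct {n : ℕ} {X : Set (Fin n → ℕ)} (hX : SwapStable X) (i : Fin (n - 1)) (w : X) :
    X →₀ ℂ :=
  if w.1 ⟨(i : ℕ), by omega⟩ < w.1 ⟨(i : ℕ) + 1, by omega⟩ then
    Finsupp.single ⟨swapWord i w.1, hX i w.1 w.2⟩ 1
  else if w.1 ⟨(i : ℕ), by omega⟩ = w.1 ⟨(i : ℕ) + 1, by omega⟩ then 0
  else -Finsupp.single w 1

/-- The linear operator `w ↦ w · T_i`. -/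
def wordOp {n : ℕ} {X : Set (Fin n → ℕ)} (hX : SwapStable X) (i : Fin (n - 1)) :
    (X →₀ ℂ) →ₗ[ℂ] (X →₀ ℂ) :=
  Finsupp.linearCombination ℂ (wordAct hX i)

theorem wordOp_single {n : ℕ} {X : Set (Fin n → ℕ)} (hX : SwapStable X) (i : Fin (n - 1))
    (w : X) : wordOp hX i (Finsupp.single w 1) = wordAct hX i w := by
  simp [wordOp]

theorem wordOp_quad {n : ℕ} {X : Set (Fin n → ℕ)} (hX : SwapStable X) (i : Fin (n - 1)) :
    wordOp hX i * wordOp hX i = -wordOp hX i := by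
  refine Finsupp.lhom_ext' fun w => LinearMap.ext_ring ?_
  simp only [LinearMap.comp_apply, Finsupp.lsingle_apply, Module.End.mul_apply,
    LinearMap.neg_apply, wordOp_single]
  rcases lt_trichotomy (w.1 ⟨(i : ℕ), by omega⟩) (w.1 ⟨(i : ℕ) + 1, by omega⟩) with h | h | h
  · simp [wordAct, wordOp_single, swapWord_apply, h, h.not_gt, h.ne']
  · simp [wordAct, h]
  · simp [wordAct, wordOp_single, h.not_gt, h.ne']

theorem wordOp_comm {n : ℕ} {X : Set (Fin n → ℕ)} (hX : SwapStable X) (i j : Fin (n - 1))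
    (hij : (i : ℕ) + 1 < j) : wordOp hX i * wordOp hX j = wordOp hX j * wordOp hX i := by
  refine Finsupp.lhom_ext' fun w => LinearMap.ext_ring ?_
  simp only [LinearMap.comp_apply, Finsupp.lsingle_apply, Module.End.mul_apply, wordOp_single]
  have e : swapWord i (swapWord j w.1) = swapWord j (swapWord i w.1) := by
    funext ⟨m, hm⟩
    simp only [swapWord_apply]
    split_ifs <;> first | rfl | omega
  have h1 : (i : ℕ) ≠ j := by omega
  have h2 : (i : ℕ) ≠ j + 1 := by omega
  have h3 : (i : ℕ) + 1 ≠ j := by omega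
  have h4 : (j : ℕ) ≠ i + 1 := by omega
  have h5 : (j : ℕ) ≠ i := by omega
  have h6 : (j : ℕ) + 1 ≠ i := by omega
  have ei : ∀ u : Fin n → ℕ, swapWord j u ⟨(i : ℕ), by omega⟩ = u ⟨(i : ℕ), by omega⟩ := by
    intro u; simp [swapWord_apply, h1, h2]
  have ei' : ∀ u : Fin n → ℕ,
      swapWord j u ⟨(i : ℕ) + 1, by omega⟩ = u ⟨(i : ℕ) + 1, by omega⟩ := by
    intro u; simp [swapWord_apply, h1, h3]
  have ej : ∀ u : Fin n → ℕ, swapWord i u ⟨(j : ℕ), by omega⟩ = u ⟨(j : ℕ), by omega⟩ := by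
    intro u; simp [swapWord_apply, h4, h5]
  have ej' : ∀ u : Fin n → ℕ,
      swapWord i u ⟨(j : ℕ) + 1, by omega⟩ = u ⟨(j : ℕ) + 1, by omega⟩ := by
    intro u; simp [swapWord_apply, h5, h6]
  simp only [wordAct]
  split_ifs <;> simp_all [wordAct, wordOp_single, not_lt_of_ge]

set_option linter.unusedSimpArgs false in
theorem wordOp_braid {n : ℕ} {X : Set (Fin n → ℕ)} (hX : SwapStable X) (i j : Fin (n - 1))
    (hij : (i : ℕ) + 1 = j) :
    wordOp hX i * wordOp hX j * wordOp hX i = wordOp hX j * wordOp hX i * wordOp hX j := by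
  obtain ⟨i, hi⟩ := i
  obtain ⟨j, hj⟩ := j
  simp only at hij
  subst hij
  refine Finsupp.lhom_ext' fun w => LinearMap.ext_ring ?_
  simp only [LinearMap.comp_apply, Finsupp.lsingle_apply, Module.End.mul_apply, wordOp_single]
  have e : swapWord ⟨i, hi⟩ (swapWord ⟨i + 1, hj⟩ (swapWord ⟨i, hi⟩ w.1)) =
      swapWord ⟨i + 1, hj⟩ (swapWord ⟨i, hi⟩ (swapWord ⟨i + 1, hj⟩ w.1)) := by
    funext ⟨m, hm⟩
    simp only [swapWord_apply]
    split_ifs <;> first | rfl | omega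
  have n1 : i ≠ i + 1 + 1 := by omega
  have n2 : i + 1 + 1 ≠ i := by omega
  have key : ∀ a b c : ℕ,
      (a < b ∨ a = b ∨ b < a) ∧ (b < c ∨ b = c ∨ c < b) ∧ (a < c ∨ a = c ∨ c < a) := by
    intro a b c; omega
  obtain ⟨k1, k2, k3⟩ := key (w.1 ⟨i, by omega⟩) (w.1 ⟨i + 1, by omega⟩) (w.1 ⟨i + 1 + 1, by omega⟩)
  rcases k1 with k1 | k1 | k1 <;> rcases k2 with k2 | k2 | k2 <;> rcases k3 with k3 | k3 | k3 <;>
  first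
  | (exfalso; omega)
  | (simp [wordAct, wordOp_single, swapWord_apply, n1, n2, e, k1, k2, k3,
      k1.not_gt, k1.ne', k2.not_gt, k2.ne', k3.not_gt, k3.ne']; done)
  | (simp [wordAct, wordOp_single, swapWord_apply, n1, n2, e, k1, k2, k3,
      k2.not_gt, k2.ne', k3.not_gt, k3.ne']; done)
  | (simp [wordAct, wordOp_single, swapWord_apply, n1, n2, e, k1, k2, k3,
      k1.not_gt, k1.ne', k3.not_gt, k3.ne']; done)
  | (simp [wordAct, wordOp_single, swapWord_apply, n1, n2, e, k1, k2, k3,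
      k1.not_gt, k1.ne', k2.not_gt, k2.ne']; done)
  | (simp [wordAct, wordOp_single, swapWord_apply, n1, n2, e, k1, k2, k3]; done)

theorem wordOp_rel {n : ℕ} {X : Set (Fin n → ℕ)} (hX : SwapStable X) :
    ∀ ⦃x y : FreeAlgebra ℂ (Fin (n - 1))⦄, HeckeRel n x y →
      FreeAlgebra.lift ℂ (fun i => MulOpposite.op (wordOp hX i)) x =
        FreeAlgebra.lift ℂ (fun i => MulOpposite.op (wordOp hX i)) y := by
  intro x y h
  cases h with
  | quad i =>
    simp only [map_mul, map_neg, FreeAlgebra.lift_ι_apply, ← MulOpposite.op_mul, wordOp_quad,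
      MulOpposite.op_neg]
  | comm i j h =>
    simp only [map_mul, FreeAlgebra.lift_ι_apply, ← MulOpposite.op_mul, wordOp_comm hX i j h]
  | braid i j h =>
    simp only [map_mul, FreeAlgebra.lift_ι_apply, ← MulOpposite.op_mul, ← mul_assoc,
      wordOp_braid hX i j h]

/-- The right action of `H_n(0)` on the span of `X`, as an algebra morphism from `H_n(0)` to the
opposite of the endomorphism algebra. -/
def wordRep {n : ℕ} {X : Set (Fin n → ℕ)} (hX : SwapStable X) :
    HeckeZero n →ₐ[ℂ] (Module.End ℂ (X →₀ ℂ))ᵐᵒᵖ :=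
  RingQuot.liftAlgHom ℂ
    ⟨FreeAlgebra.lift ℂ (fun i => MulOpposite.op (wordOp hX i)), wordOp_rel hX⟩

/-- The permutational right `H_n(0)`-module with basis `X`. -/
def WordModule {n : ℕ} {X : Set (Fin n → ℕ)} (_hX : SwapStable X) : Type := X →₀ ℂ

instance {n : ℕ} {X : Set (Fin n → ℕ)} (hX : SwapStable X) : AddCommGroup (WordModule hX) :=
  inferInstanceAs (AddCommGroup (X →₀ ℂ))

instance {n : ℕ} {X : Set (Fin n → ℕ)} (hX : SwapStable X) :
    Module (HeckeZero n)ᵐᵒᵖ (WordModule hX) :=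
  Module.compHom (X →₀ ℂ) (AlgHom.opComm (wordRep hX)).toRingHom

/-! ### Parking functions -/

/-- The nondecreasing rearrangement of a word. -/
def sortWord {n : ℕ} (a : Fin n → ℕ) : Fin n → ℕ := a ∘ Tuple.sort a

/-- The `(k,l)`-parking functions of length `n`: the words `a` over `{1, …, l + (n - 1) k}` whose
nondecreasing rearrangement `a'_1 ≤ ⋯ ≤ a'_n` satisfies `a'_i ≤ l + (i - 1) k` for all `i`
(in the code, `i` starts from `0`). -/
def PF (k l n : ℕ) : Set (Fin n → ℕ) :=
  {a | (∀ i, 1 ≤ a i ∧ a i ≤ l + (n - 1) * k) ∧ ∀ i : Fin n, sortWord a i ≤ l + (i : ℕ) * k}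

theorem PF_swapStable (k l n : ℕ) : SwapStable (PF k l n) := by
  rintro i w ⟨h1, h2⟩
  refine ⟨fun m => h1 _, ?_⟩
  have : sortWord (swapWord i w) = sortWord w := Tuple.comp_perm_comp_sort_eq_comp_sort
  rw [this]
  exact h2

/-- The permutational right `H_n(0)`-module on `(k,l)`-parking functions of length `n`. -/
abbrev PFModule (k l n : ℕ) : Type := WordModule (PF_swapStable k l n)

/-! ### Noncommutative symmetric functions -/

/-- The algebra of noncommutative symmetric functions, freely generated by `S_1, S_2, …`. -/
abbrev NSym : Type := FreeAlgebra ℂ ℕ+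

/-- The complete function `S_n`, with `S_0 = 1`. -/
def S (n : ℕ) : NSym := if h : 0 < n then FreeAlgebra.ι ℂ (⟨n, h⟩ : ℕ+) else 1

/-- `S^I = S_{i_1} ⋯ S_{i_r}`. -/
def SProd {n : ℕ} (I : Composition n) : NSym := (I.blocks.map S).prod

/-- The ribbon function `R_I`: the sum of `(-1)^{ℓ(I) - ℓ(J)} S^J` over the compositions `J` that
are coarser than or equal to `I`. -/
def ribbon {n : ℕ} (I : Composition n) : NSym :=
  ∑ J : Composition n with J.boundaries ⊆ I.boundaries,
    (-1 : NSym) ^ (I.length - J.length) * SProd J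

/-- A formal power series with constant term `1`, as a unit. -/
def unitOfOne (f : NSym⟦X⟧) (h : constantCoeff f = 1) : NSym⟦X⟧ˣ where
  val := f
  inv := invOfUnit f 1
  val_inv := mul_invOfUnit f 1 h
  inv_val := invOfUnit_mul f 1 h

/-- `σ_t(A) = ∑ t^n S_n(A)`; the variable `t` is central. -/
def sigma : NSym⟦X⟧ˣ :=
  unitOfOne (PowerSeries.mk S) (by simp [S])

/-- `S_n(mA)` for an integer `m`, defined by `∑ t^n S_n(mA) = σ_t(A)^m`. -/
def SMul (m : ℤ) (n : ℕ) : NSym := coeff n ((sigma ^ m : NSym⟦X⟧ˣ) : NSym⟦X⟧)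

theorem constantCoeff_unit_zpow (u : NSym⟦X⟧ˣ) (h : constantCoeff (u : NSym⟦X⟧) = 1) (m : ℤ) :
    constantCoeff ((u ^ m : NSym⟦X⟧ˣ) : NSym⟦X⟧) = 1 := by
  have h' : Units.map (constantCoeff (R := NSym)).toMonoidHom u = 1 := Units.ext h
  have := map_zpow (Units.map (constantCoeff (R := NSym)).toMonoidHom) u m
  rw [h', one_zpow] at this
  exact congrArg Units.val this

/-- `F(r,k) = ∑ S_n((nk + r)A)`, the term of degree `n` being the coefficient of `t^n`. -/
def F (r : ℤ) (k : ℕ) : NSym⟦X⟧ˣ :=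
  unitOfOne (PowerSeries.mk fun n => SMul (n * k + r) n) (by
    simpa [SMul] using constantCoeff_unit_zpow sigma (by simp [sigma, unitOfOne, S]) r)

/-- The series `g^{(k,l)}(A) = F(r,k) F(r-l,k)^{-1}`. -/
def g (k l : ℕ) (r : ℤ) : NSym⟦X⟧ := ((F r k * (F (r - l) k)⁻¹ : NSym⟦X⟧ˣ) : NSym⟦X⟧)

/-! ### The noncommutative characteristic -/

/-- `P` is the indecomposable projective module `P_I`, that is, a projective cover of the simple
module `φ_I`: it is projective, and it surjects onto `φ_I` with superfluous kernel. -/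
def IsProjectiveCover {n : ℕ} (I : Composition n) (P : Type*) [AddCommGroup P]
    [Module (HeckeZero n)ᵐᵒᵖ P] : Prop :=
  Module.Projective (HeckeZero n)ᵐᵒᵖ P ∧
    ∃ f : P →ₗ[(HeckeZero n)ᵐᵒᵖ] SimpleModule I, Function.Surjective f ∧
      ∀ N : Submodule (HeckeZero n)ᵐᵒᵖ P, N ⊔ LinearMap.ker f = ⊤ → N = ⊤

/-- `c` is the noncommutative characteristic of the finitely generated projective right
`H_n(0)`-module `M`: the characteristic is additive on direct sums and sends `P_I` to `R_I`, so
that `M = ⨁_j P_{I_j}` has characteristic `∑_j R_{I_j}`. -/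
def IsCharacteristic (n : ℕ) (M : Type*) [AddCommGroup M] [Module (HeckeZero n)ᵐᵒᵖ M]
    (c : NSym) : Prop :=
  ∃ (m : ℕ) (N : Fin m → Submodule (HeckeZero n)ᵐᵒᵖ M) (I : Fin m → Composition n),
    DirectSum.IsInternal N ∧ (∀ j, IsProjectiveCover (I j) (N j)) ∧ c = ∑ j, ribbon (I j)

end NCParking

end

noncomputable section

namespace NCParking

open PowerSeries

section

/-! ### Extending a function from nondecreasing words to all words -/

/-! A permutational module is generated by its nondecreasing words `v`, and the relations `v · T_i =
0` at equal neighbouring letters suffice: morphisms out of it are determined by, and can be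
prescribed on, these words (`wordModule_hom_ext`, `exists_wordModule_hom`). Consistency of the
prescription is a confluence argument using only the commutation and braid relations
(`sortExt_descent`, `sortExt_eq_letters`). Projectivity then means lifting a vector killed by some
of the `T_i` to a vector killed by the same `T_i` (`exists_lift_killed`); the operators `1 + T_i`,
which are braided and satisfy `(1 + T_i) T_i = 0`, produce such a lift.

In a decomposition of a projective module, the multiplicity of `P_J` is the dimension of the space
of morphisms to `φ_J`, since a superfluous kernel leaves `P_I` only one simple quotient
(`charHom_of_isProjectiveCover`). Decompositions exist by a Fitting argument
(`exists_cover_summand`). For a permutational module this dimension counts the nondecreasing words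
that rise strictly at every descent of `J` (`finrank_charHom_wordModule`). Summing over `J` first, a
word `v` contributes all `R_J` whose descents are ascents of `v`; by Möbius inversion (`sum_ribbon`)
this is `S^I`, with `I` the composition of letter multiplicities of `v`. The characteristic is
therefore `parkingSum`, the weight sum of the nondecreasing parking functions.

It remains to identify its generating series `P` with `g`. For `m ≥ 0`, `S_n(mA)` is the weight sum
of the nondecreasing words over `m` letters (`SMul_natCast`). Cutting such a word, with `m = l +
nk`, at the first position `i` (counted from `0`) whose letter exceeds `l + ik` gives `F(l,k) = P
F(0,k)` (`SMul_eq_sum_parkingSum`). Multiplication by `σ_t(A)` together with induction on the degree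
carries this to `F(r,k) = P F(r-l,k)` for every integer `r` (`defect_eq_zero`), so `P` is `F(r,k)
F(r-l,k)⁻¹` whatever `r` is. -/

/-- The letter in position `i` (for `i : Fin (n - 1)`, counted from `0`). -/
def letL {n : ℕ} (w : Fin n → ℕ) (i : Fin (n - 1)) : ℕ := w ⟨(i : ℕ), by omega⟩

/-- The letter in position `i + 1`. -/
def letR {n : ℕ} (w : Fin n → ℕ) (i : Fin (n - 1)) : ℕ := w ⟨(i : ℕ) + 1, by omega⟩

theorem swapWord_sum_lt {n : ℕ} (φ : ℕ → ℕ) (i : Fin (n - 1)) (w : Fin n → ℕ)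
    (h : φ (i : ℕ) * letR w i + φ ((i : ℕ) + 1) * letL w i <
      φ (i : ℕ) * letL w i + φ ((i : ℕ) + 1) * letR w i) :
    ∑ p : Fin n, φ p * swapWord i w p < ∑ p : Fin n, φ p * w p := by
  classical
  have hab : (⟨(i : ℕ), by omega⟩ : Fin n) ≠ ⟨(i : ℕ) + 1, by omega⟩ := by
    simp [Fin.ext_iff]
  rw [← Finset.sum_add_sum_compl {(⟨(i : ℕ), by omega⟩ : Fin n), ⟨(i : ℕ) + 1, by omega⟩},
    ← Finset.sum_add_sum_compl {(⟨(i : ℕ), by omega⟩ : Fin n), ⟨(i : ℕ) + 1, by omega⟩}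
      (fun p : Fin n => φ p * w p), Finset.sum_pair hab, Finset.sum_pair hab]
  refine add_lt_add_of_lt_of_le ?_ (le_of_eq (Finset.sum_congr rfl ?_))
  · simpa [swapWord_apply, letL, letR] using h
  · rintro ⟨p, hp⟩ hp'
    simp only [Finset.mem_compl, Finset.mem_insert, Finset.mem_singleton, Fin.mk.injEq,
      not_or] at hp'
    rw [swapWord_apply, if_neg hp'.1, if_neg hp'.2]

/-- A weight that decreases when a descent is exchanged. -/
def sortWeight {n : ℕ} (w : Fin n → ℕ) : ℕ := ∑ p : Fin n, (n - (p : ℕ)) * w p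

/-- A weight that decreases when an ascent is exchanged. -/
def revWeight {n : ℕ} (w : Fin n → ℕ) : ℕ := ∑ p : Fin n, (p : ℕ) * w p

theorem sortWeight_swapWord_lt {n : ℕ} (i : Fin (n - 1)) (w : Fin n → ℕ)
    (h : letR w i < letL w i) : sortWeight (swapWord i w) < sortWeight w := by
  refine swapWord_sum_lt (fun p => n - p) i w ?_
  -- The two affected coefficients are consecutive; naming them removes the truncated subtraction.
  obtain ⟨c, hc⟩ : ∃ c, n - (i : ℕ) = c + 1 := ⟨n - i - 1, by omega⟩
  have hc' : n - ((i : ℕ) + 1) = c := by omega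
  simp only [hc, hc']
  nlinarith

theorem revWeight_swapWord_lt {n : ℕ} (i : Fin (n - 1)) (w : Fin n → ℕ)
    (h : letL w i < letR w i) : revWeight (swapWord i w) < revWeight w := by
  refine swapWord_sum_lt (fun p => p) i w ?_
  nlinarith

@[simp] theorem letL_swapWord {n : ℕ} (i : Fin (n - 1)) (w : Fin n → ℕ) :
    letL (swapWord i w) i = letR w i := by
  simp [letL, letR, swapWord_apply]

@[simp] theorem letR_swapWord {n : ℕ} (i : Fin (n - 1)) (w : Fin n → ℕ) :
    letR (swapWord i w) i = letL w i := by
  simp [letL, letR, swapWord_apply]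

@[simp] theorem swapWord_swapWord {n : ℕ} (i : Fin (n - 1)) (w : Fin n → ℕ) :
    swapWord i (swapWord i w) = w := by
  funext x
  simp [swapWord]

theorem swapWord_comm {n : ℕ} (i j : Fin (n - 1)) (h : (i : ℕ) + 1 < j) (w : Fin n → ℕ) :
    swapWord i (swapWord j w) = swapWord j (swapWord i w) := by
  funext ⟨m, hm⟩
  simp only [swapWord_apply]
  split_ifs <;> first | rfl | omega

theorem swapWord_braid {n : ℕ} (i j : Fin (n - 1)) (h : (i : ℕ) + 1 = j) (w : Fin n → ℕ) :
    swapWord i (swapWord j (swapWord i w)) = swapWord j (swapWord i (swapWord j w)) := by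
  obtain ⟨j, hj⟩ := j
  simp only at h
  subst h
  funext ⟨m, hm⟩
  simp only [swapWord_apply]
  split_ifs <;> first | rfl | omega

/-- Far positions are not affected by an exchange. -/
theorem let_swapWord_of_far {n : ℕ} (i j : Fin (n - 1)) (w : Fin n → ℕ)
    (h : (i : ℕ) + 1 < j ∨ (j : ℕ) + 1 < i) :
    letL (swapWord i w) j = letL w j ∧ letR (swapWord i w) j = letR w j := by
  constructor
  · simp only [letL, swapWord_apply]
    rw [if_neg (by omega), if_neg (by omega)]
  · simp only [letR, swapWord_apply]
    rw [if_neg (by omega), if_neg (by omega)]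

theorem let_swapWord_succ {n : ℕ} (i j : Fin (n - 1)) (w : Fin n → ℕ) (h : (i : ℕ) + 1 = j) :
    letL w j = letR w i ∧
    letL (swapWord i w) j = letL w i ∧ letR (swapWord i w) j = letR w j ∧
      letL (swapWord j w) i = letL w i ∧ letR (swapWord j w) i = letR w j := by
  obtain ⟨j, hj⟩ := j
  simp only at h
  subst h
  refine ⟨?_, ?_, ?_, ?_, ?_⟩ <;> simp only [letL, letR, swapWord_apply] <;> split_ifs <;>
    first | rfl | omega

theorem monotone_of_letL_le_letR {n : ℕ} {w : Fin n → ℕ} (h : ∀ i, letL w i ≤ letR w i) :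
    Monotone w := by
  cases n with
  | zero => exact fun a => a.elim0
  | succ n => exact Fin.monotone_iff_le_succ.2 fun i => h i

theorem letL_le_letR_of_monotone {n : ℕ} {w : Fin n → ℕ} (h : Monotone w) (i : Fin (n - 1)) :
    letL w i ≤ letR w i :=
  h (by simp [Fin.le_def])

/-- The commutation and braid relations for a family of maps. -/
structure IsBraided {n : ℕ} {A : Type*} (U : Fin (n - 1) → A → A) : Prop where
  comm : ∀ i j : Fin (n - 1), (i : ℕ) + 1 < j → ∀ a, U i (U j a) = U j (U i a)
  braid : ∀ i j : Fin (n - 1), (i : ℕ) + 1 = j → ∀ a, U i (U j (U i a)) = U j (U i (U j a))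

open Classical in
/-- The extension to all words of a function `a` on nondecreasing words such that
`f (w σ_i) = U_i (f w)` at each ascent `i` of `w`. -/
def sortExt {n : ℕ} {A : Type*} (U : Fin (n - 1) → A → A) (a : (Fin n → ℕ) → A)
    (w : Fin n → ℕ) : A :=
  if h : ∃ i, letR w i < letL w i then U h.choose (sortExt U a (swapWord h.choose w)) else a w
termination_by sortWeight w
decreasing_by exact sortWeight_swapWord_lt _ _ h.choose_spec

variable {n : ℕ} {A : Type*} {U : Fin (n - 1) → A → A}

theorem sortExt_of_monotone (U : Fin (n - 1) → A → A) (a : (Fin n → ℕ) → A) {w : Fin n → ℕ}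
    (hw : Monotone w) : sortExt U a w = a w := by
  rw [sortExt, dif_neg]
  rintro ⟨i, hi⟩
  exact absurd (letL_le_letR_of_monotone hw i) (not_le.2 hi)

/-- The definition sorts along an arbitrarily chosen descent; the point is independence of that
choice. Any two descents can be resolved to a common word, where the relations among the `U_i` make
both results agree. -/
theorem sortExt_descent (hU : IsBraided U) (a : (Fin n → ℕ) → A) (w : Fin n → ℕ)
    (i : Fin (n - 1)) (hi : letR w i < letL w i) :
    sortExt U a w = U i (sortExt U a (swapWord i w)) := by
  induction hN : sortWeight w using Nat.strong_induction_on generalizing w i with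
  | _ N ih =>
  subst hN
  have ih' : ∀ u, sortWeight u < sortWeight w → ∀ i, letR u i < letL u i →
      sortExt U a u = U i (sortExt U a (swapWord i u)) := fun u hu i hi => ih _ hu u i hi rfl
  have main : ∀ i j : Fin (n - 1), (i : ℕ) < j → letR w i < letL w i → letR w j < letL w j →
      U i (sortExt U a (swapWord i w)) = U j (sortExt U a (swapWord j w)) := by
    intro i j hij hi hj
    have wi := sortWeight_swapWord_lt i w hi
    have wj := sortWeight_swapWord_lt j w hj
    rcases Nat.lt_or_ge ((i : ℕ) + 1) j with h | h
    · obtain ⟨e1, e2⟩ := let_swapWord_of_far i j w (Or.inl h)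
      obtain ⟨e3, e4⟩ := let_swapWord_of_far j i w (Or.inr h)
      rw [ih' _ wi j (by rwa [e1, e2]), ih' _ wj i (by rwa [e3, e4]), hU.comm i j h,
        swapWord_comm i j h]
    -- Adjacent descents mean three strictly decreasing letters; both routes end by reversing this
    -- block, in the two orders that the braid relation equates.
    · have h : (i : ℕ) + 1 = j := by omega
      obtain ⟨e0, e1, e2, e3, e4⟩ := let_swapWord_succ i j w h
      have d1 : letR (swapWord i w) j < letL (swapWord i w) j := by
        rw [e1, e2]; omega
      have d2 : letR (swapWord j w) i < letL (swapWord j w) i := by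
        rw [e3, e4]; omega
      obtain ⟨f0, f1, f2, f3, f4⟩ := let_swapWord_succ i j (swapWord i w) h
      obtain ⟨g0, g1, g2, g3, g4⟩ := let_swapWord_succ i j (swapWord j w) h
      have d3 : letR (swapWord j (swapWord i w)) i < letL (swapWord j (swapWord i w)) i := by
        rw [f3, f4, letL_swapWord, e2]; omega
      have d4 : letR (swapWord i (swapWord j w)) j < letL (swapWord i (swapWord j w)) j := by
        rw [g1, g2, letR_swapWord, e3]; omega
      rw [ih' _ wi j d1, ih' _ ((sortWeight_swapWord_lt _ _ d1).trans wi) i d3,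
        ih' _ wj i d2, ih' _ ((sortWeight_swapWord_lt _ _ d2).trans wj) j d4,
        hU.braid i j h, swapWord_braid i j h]
  have hex : ∃ i, letR w i < letL w i := ⟨i, hi⟩
  rw [sortExt, dif_pos hex]
  rcases lt_trichotomy (hex.choose : ℕ) (i : ℕ) with h | h | h
  · exact main _ _ h hex.choose_spec hi
  · rw [Fin.ext h]
  · exact (main _ _ h hi hex.choose_spec).symm

theorem sortExt_ascent (hU : IsBraided U) (a : (Fin n → ℕ) → A) (w : Fin n → ℕ)
    (i : Fin (n - 1)) (hi : letL w i < letR w i) :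
    sortExt U a (swapWord i w) = U i (sortExt U a w) := by
  rw [sortExt_descent hU a (swapWord i w) i (by simpa using hi), swapWord_swapWord]

/-- If `U_i` kills the value at each nondecreasing word with equal letters in positions `i` and
`i + 1`, then this holds for all words. -/
theorem sortExt_eq_letters [Zero A] (hU : IsBraided U) (h0 : ∀ i, U i 0 = 0)
    (a : (Fin n → ℕ) → A) (w : Fin n → ℕ)
    (ha : ∀ v, (∃ π : Equiv.Perm (Fin n), v = w ∘ π) → Monotone v →
      ∀ i, letL v i = letR v i → U i (a v) = 0)
    (i : Fin (n - 1)) (hi : letL w i = letR w i) : U i (sortExt U a w) = 0 := by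
  induction hN : sortWeight w using Nat.strong_induction_on generalizing w i with
  | _ N ih =>
  subst hN
  -- The hypothesis `ha` only concerns rearrangements of the word, so it survives exchanges.
  have hperm : ∀ (u : Fin n → ℕ) (j : Fin (n - 1)), (∀ v, (∃ π : Equiv.Perm (Fin n), v = u ∘ π) →
      Monotone v → ∀ i, letL v i = letR v i → U i (a v) = 0) →
      ∀ v, (∃ π : Equiv.Perm (Fin n), v = swapWord j u ∘ π) →
      Monotone v → ∀ i, letL v i = letR v i → U i (a v) = 0 := by
    rintro u j hu v ⟨π, rfl⟩
    exact hu _ ⟨Equiv.swap _ _ * π, rfl⟩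
  by_cases hm : Monotone w
  · rw [sortExt_of_monotone U a hm]
    exact ha w ⟨1, rfl⟩ hm i hi
  obtain ⟨j, hj⟩ : ∃ j, letR w j < letL w j := by
    by_contra! h
    exact hm (monotone_of_letL_le_letR h)
  have wj := sortWeight_swapWord_lt j w hj
  rw [sortExt_descent hU a w j hj]
  have far : ((i : ℕ) + 1 < j ∨ (j : ℕ) + 1 < i) → U i (U j (sortExt U a (swapWord j w))) = 0 := by
    intro h
    have e : U i (U j (sortExt U a (swapWord j w))) = U j (U i (sortExt U a (swapWord j w))) := by
      rcases h with h | h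
      · exact hU.comm i j h _
      · exact (hU.comm j i h _).symm
    obtain ⟨e1, e2⟩ := let_swapWord_of_far j i w h.symm
    rw [e, ih _ wj _ (hperm _ _ ha) i (by rw [e1, e2, hi]) rfl, h0]
  rcases lt_trichotomy (i : ℕ) (j : ℕ) with h | h | h
  · rcases Nat.lt_or_ge ((i : ℕ) + 1) j with h' | h'
    · exact far (Or.inl h')
    -- The block is `x x z` with `z < x`. Exchanging at `j`, then at `i`, gives `z x x`, with the
    -- equality now at `j`; the braid relation brings `U_j` next to that value.
    have h : (i : ℕ) + 1 = j := by omega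
    obtain ⟨e0, e1, e2, e3, e4⟩ := let_swapWord_succ i j w h
    have d2 : letR (swapWord j w) i < letL (swapWord j w) i := by
      rw [e3, e4]; omega
    obtain ⟨g0, g1, g2, g3, g4⟩ := let_swapWord_succ i j (swapWord j w) h
    rw [sortExt_descent hU a _ i d2, hU.braid i j h,
      ih _ ((sortWeight_swapWord_lt _ _ d2).trans wj) _ (hperm _ _ (hperm _ _ ha)) j
        (by rw [g1, g2, letR_swapWord, e3]; omega) rfl, h0, h0]
  · exact absurd hi (by rw [Fin.ext h]; omega)
  · rcases Nat.lt_or_ge ((j : ℕ) + 1) i with h' | h'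
    · exact far (Or.inr h')
    have h : (j : ℕ) + 1 = i := by omega
    obtain ⟨e0, e1, e2, e3, e4⟩ := let_swapWord_succ j i w h
    have d2 : letR (swapWord j w) i < letL (swapWord j w) i := by
      rw [e1, e2]; omega
    obtain ⟨g0, g1, g2, g3, g4⟩ := let_swapWord_succ j i (swapWord j w) h
    rw [sortExt_descent hU a _ i d2, ← hU.braid j i h,
      ih _ ((sortWeight_swapWord_lt _ _ d2).trans wj) _ (hperm _ _ (hperm _ _ ha)) j
        (by rw [g3, g4, letL_swapWord, e2]; omega) rfl, h0, h0]

end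

section

/-! ### Modules over the 0-Hecke algebra -/

open MulOpposite

instance {n : ℕ} {X : Set (Fin n → ℕ)} (hX : SwapStable X) : Module ℂ (WordModule hX) :=
  inferInstanceAs (Module ℂ (X →₀ ℂ))

theorem WordModule.smul_def {n : ℕ} {X : Set (Fin n → ℕ)} (hX : SwapStable X)
    (a : (HeckeZero n)ᵐᵒᵖ) (m : WordModule hX) :
    a • m = (AlgHom.opComm (wordRep hX) a : Module.End ℂ (X →₀ ℂ)) m := rfl

instance {n : ℕ} {X : Set (Fin n → ℕ)} (hX : SwapStable X) :
    IsScalarTower ℂ (HeckeZero n)ᵐᵒᵖ (WordModule hX) where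
  smul_assoc c a m := by
    rw [WordModule.smul_def, map_smul]
    rfl

instance {n : ℕ} (I : Composition n) : Module ℂ (SimpleModule I) :=
  inferInstanceAs (Module ℂ ℂ)

theorem SimpleModule.smul_def {n : ℕ} (I : Composition n)
    (a : (HeckeZero n)ᵐᵒᵖ) (z : SimpleModule I) :
    a • z = simpleChar I a.unop • z := rfl

instance {n : ℕ} (I : Composition n) :
    IsScalarTower ℂ (HeckeZero n)ᵐᵒᵖ (SimpleModule I) where
  smul_assoc c a m := by
    rw [SimpleModule.smul_def, MulOpposite.unop_smul, map_smul, smul_assoc]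
    rfl

theorem heckeT_smul_simple {n : ℕ} (I : Composition n) (i : Fin (n - 1)) (z : SimpleModule I) :
    op (heckeT i) • z = simpleVal I i • z := by
  rw [SimpleModule.smul_def, unop_op, simpleChar, heckeT, RingQuot.liftAlgHom_mkAlgHom_apply,
    FreeAlgebra.lift_ι_apply]

/-- A word, as a basis element of the permutational module. -/
def wordBasis {n : ℕ} {X : Set (Fin n → ℕ)} (hX : SwapStable X) (w : X) : WordModule hX :=
  (Finsupp.single w 1 : X →₀ ℂ)

theorem heckeT_smul_wordBasis {n : ℕ} {X : Set (Fin n → ℕ)} (hX : SwapStable X)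
    (i : Fin (n - 1)) (w : X) :
    op (heckeT i) • wordBasis hX w = (wordAct hX i w : X →₀ ℂ) := by
  rw [WordModule.smul_def, ← wordOp_single]
  change (unop (wordRep hX (heckeT i)) : Module.End ℂ (X →₀ ℂ)) _ = _
  rw [wordRep, heckeT, RingQuot.liftAlgHom_mkAlgHom_apply, FreeAlgebra.lift_ι_apply, unop_op]
  rfl

theorem heckeT_smul_wordBasis_of_lt {n : ℕ} {X : Set (Fin n → ℕ)} (hX : SwapStable X)
    (i : Fin (n - 1)) (w : X) (h : letL w.1 i < letR w.1 i) :
    op (heckeT i) • wordBasis hX w = wordBasis hX ⟨swapWord i w.1, hX i w.1 w.2⟩ := by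
  exact (heckeT_smul_wordBasis hX i w).trans (if_pos h)

theorem heckeT_smul_wordBasis_of_eq {n : ℕ} {X : Set (Fin n → ℕ)} (hX : SwapStable X)
    (i : Fin (n - 1)) (w : X) (h : letL w.1 i = letR w.1 i) :
    op (heckeT i) • wordBasis hX w = 0 := by
  exact (heckeT_smul_wordBasis hX i w).trans ((if_neg h.not_lt).trans (if_pos h))

theorem heckeT_smul_wordBasis_of_gt {n : ℕ} {X : Set (Fin n → ℕ)} (hX : SwapStable X)
    (i : Fin (n - 1)) (w : X) (h : letR w.1 i < letL w.1 i) :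
    op (heckeT i) • wordBasis hX w = -wordBasis hX w := by
  exact (heckeT_smul_wordBasis hX i w).trans ((if_neg h.not_gt).trans (if_neg h.ne'))

variable {n : ℕ}

theorem wordModule_linearMap_ext {X : Set (Fin n → ℕ)} (hX : SwapStable X) {N : Type*}
    [AddCommGroup N] [Module ℂ N] {f g : WordModule hX →ₗ[ℂ] N}
    (h : ∀ w, f (wordBasis hX w) = g (wordBasis hX w)) : f = g :=
  Finsupp.lhom_ext' fun w => LinearMap.ext_ring (h w)

/-- The linear map with given values on words. -/
def wordLinearMap {X : Set (Fin n → ℕ)} (hX : SwapStable X) {N : Type*}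
    [AddCommGroup N] [Module ℂ N] (f : X → N) : WordModule hX →ₗ[ℂ] N :=
  Finsupp.linearCombination ℂ f

@[simp] theorem wordLinearMap_wordBasis {X : Set (Fin n → ℕ)} (hX : SwapStable X) {N : Type*}
    [AddCommGroup N] [Module ℂ N] (f : X → N) (w : X) :
    wordLinearMap hX f (wordBasis hX w) = f w :=
  (Finsupp.linearCombination_single ℂ 1 w).trans (one_smul ℂ _)


/-! ### Relations among the generators and their action on modules. -/

theorem heckeT_sq (i : Fin (n - 1)) : heckeT i * heckeT i = -heckeT i := by
  simpa [heckeT] using RingQuot.mkAlgHom_rel ℂ (HeckeRel.quad i)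

theorem heckeT_comm (i j : Fin (n - 1)) (h : (i : ℕ) + 1 < j) :
    heckeT i * heckeT j = heckeT j * heckeT i := by
  simpa [heckeT] using RingQuot.mkAlgHom_rel ℂ (HeckeRel.comm i j h)

theorem heckeT_braid (i j : Fin (n - 1)) (h : (i : ℕ) + 1 = j) :
    heckeT i * heckeT j * heckeT i = heckeT j * heckeT i * heckeT j := by
  simpa [heckeT] using RingQuot.mkAlgHom_rel ℂ (HeckeRel.braid i j h)

section

variable {M N : Type*} [AddCommGroup M] [Module (HeckeZero n)ᵐᵒᵖ M]
  [AddCommGroup N] [Module (HeckeZero n)ᵐᵒᵖ N]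

theorem heckeT_smul_sq (i : Fin (n - 1)) (m : M) :
    op (heckeT i) • op (heckeT i) • m = -(op (heckeT i) • m) := by
  rw [← mul_smul, ← op_mul, heckeT_sq, op_neg, neg_smul]

theorem isBraided_heckeT (M : Type*) [AddCommGroup M] [Module (HeckeZero n)ᵐᵒᵖ M] :
    IsBraided (fun (i : Fin (n - 1)) (m : M) => op (heckeT i) • m) where
  comm i j h m := by simp only [← mul_smul, ← op_mul, heckeT_comm i j h]
  braid i j h m := by
    simp only [← mul_smul, ← op_mul]
    rw [heckeT_braid i j h]

/-- The operators `1 + T_i` also satisfy the braid relations. -/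
theorem isBraided_one_add_heckeT (M : Type*) [AddCommGroup M] [Module (HeckeZero n)ᵐᵒᵖ M] :
    IsBraided (fun (i : Fin (n - 1)) (m : M) => m + op (heckeT i) • m) where
  comm i j h m := by
    have := (isBraided_heckeT M).comm i j h m
    simp only [smul_add, this]
    abel
  braid i j h m := by
    have := (isBraided_heckeT M).braid i j h m
    simp only [smul_add, heckeT_smul_sq, this]
    abel

variable [Module ℂ M] [IsScalarTower ℂ (HeckeZero n)ᵐᵒᵖ M]
  [Module ℂ N] [IsScalarTower ℂ (HeckeZero n)ᵐᵒᵖ N]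

theorem hecke_smul_of_heckeT (f : M →ₗ[ℂ] N)
    (h : ∀ (i : Fin (n - 1)) m, f (op (heckeT i) • m) = op (heckeT i) • f m)
    (a : (HeckeZero n)ᵐᵒᵖ) (m : M) : f (a • m) = a • f m := by
  induction a using MulOpposite.rec' with
  | _ a =>
  obtain ⟨x, rfl⟩ := RingQuot.mkAlgHom_surjective ℂ (HeckeRel n) a
  induction x using FreeAlgebra.induction generalizing m with
  | grade0 c =>
    rw [AlgHom.commutes, ← MulOpposite.algebraMap_apply, algebraMap_smul, algebraMap_smul,
      map_smul]
  | grade1 i => exact h i m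
  | mul x y hx hy => rw [map_mul, op_mul, mul_smul, mul_smul, hy, hx]
  | add x y hx hy => rw [map_add, op_add, add_smul, add_smul, map_add, hx, hy]

/-- A linear map commuting with the generators is a morphism of modules. -/
def heckeHom (f : M →ₗ[ℂ] N)
    (h : ∀ (i : Fin (n - 1)) m, f (op (heckeT i) • m) = op (heckeT i) • f m) :
    M →ₗ[(HeckeZero n)ᵐᵒᵖ] N where
  toFun := f
  map_add' := map_add f
  map_smul' a m := hecke_smul_of_heckeT f h a m

end

/-! ### Presentation and projectivity of permutational modules. -/

section Projective

theorem exists_revWeight_minimal {Q : Set (Fin n → ℕ)} (hQ : Q.Nonempty) :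
    ∃ w ∈ Q, ∀ u ∈ Q, revWeight w ≤ revWeight u :=
  ⟨_, Function.argminOn_mem revWeight Q hQ, fun _ hu => Function.argminOn_le revWeight Q hu⟩

/-- A set of words that is stable under exchanging consecutive letters is stable under
permutations. -/
theorem SwapStable.comp_perm {X : Set (Fin n → ℕ)} (hX : SwapStable X) {w : Fin n → ℕ}
    (hw : w ∈ X) (π : Equiv.Perm (Fin n)) : w ∘ π ∈ X := by
  cases n with
  | zero => rwa [Subsingleton.elim (w ∘ π) w]
  | succ m =>
    have hπ : π ∈ Submonoid.closure
        (Set.range fun i : Fin m => Equiv.swap i.castSucc i.succ) := by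
      rw [Equiv.Perm.mclosure_swap_castSucc_succ]
      trivial
    induction hπ using Submonoid.closure_induction generalizing w with
    | mem x hx =>
      obtain ⟨i, rfl⟩ := hx
      exact hX i w hw
    | one => exact hw
    | mul x y _ _ hx hy => exact hy (hx hw)

variable {M N : Type*} [AddCommGroup M] [Module (HeckeZero n)ᵐᵒᵖ M]
  [AddCommGroup N] [Module (HeckeZero n)ᵐᵒᵖ N]

/-- If `T_i` kills `y` for `i ∈ K`, then `y` has a preimage under a surjective morphism that is
killed by these generators. -/
theorem exists_lift_killed (p : M →ₗ[(HeckeZero n)ᵐᵒᵖ] N) (hp : Function.Surjective p)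
    (K : Set (Fin (n - 1))) (y : N) (hy : ∀ i ∈ K, op (heckeT i) • y = 0) :
    ∃ x, p x = y ∧ ∀ i ∈ K, op (heckeT i) • x = 0 := by
  obtain ⟨x0, hx0⟩ := hp y
  have hU := isBraided_one_add_heckeT (n := n) M
  set U := fun (i : Fin (n - 1)) (m : M) => m + op (heckeT i) • m with hUdef
  -- Starting from `x0`, the products of operators `1 + T_i` indexed by permutations are tried; the
  -- minimal weight selects one in which no further ascent can be exchanged while still lifting `y`.
  let Q : Set (Fin n → ℕ) := {w | Function.Injective w ∧ p (sortExt U (fun _ => x0) w) = y}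
  have hQ : Q.Nonempty := by
    refine ⟨fun i => i, fun i j h => Fin.ext h, ?_⟩
    rw [sortExt_of_monotone U _ (fun i j h => h), hx0]
  obtain ⟨w, ⟨hinj, hw⟩, hmin⟩ := exists_revWeight_minimal hQ
  refine ⟨_, hw, fun i hi => ?_⟩
  rcases lt_trichotomy (letL w i) (letR w i) with h | h | h
  -- At an ascent `i ∈ K`, applying `1 + T_i` leaves the image `y` unchanged because `T_i` kills
  -- `y`; this contradicts minimality.
  · refine absurd (revWeight_swapWord_lt i w h) (not_lt.2 (hmin _ ?_))
    refine ⟨hinj.comp (Equiv.injective _), ?_⟩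
    rw [sortExt_ascent hU _ w i h, hUdef]
    simp only [map_add, map_smul]
    rw [hw, hy i hi, add_zero]
  · have := Fin.mk.inj_iff.1 (hinj h)
    omega
  -- At a descent the vector is of the form `(1 + T_i) x'`, which `T_i` kills.
  · rw [sortExt_descent hU _ w i h]
    simp only [hUdef, smul_add, heckeT_smul_sq, add_neg_cancel]


variable [Module ℂ N]

/-- A morphism from a permutational module is determined by its values on nondecreasing words. -/
theorem wordModule_hom_ext {X : Set (Fin n → ℕ)} (hX : SwapStable X)
    {f g : WordModule hX →ₗ[ℂ] N}
    (hf : ∀ (i : Fin (n - 1)) m, f (op (heckeT i) • m) = op (heckeT i) • f m)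
    (hg : ∀ (i : Fin (n - 1)) m, g (op (heckeT i) • m) = op (heckeT i) • g m)
    (h : ∀ w : X, Monotone w.1 → f (wordBasis hX w) = g (wordBasis hX w)) : f = g := by
  refine wordModule_linearMap_ext hX fun w => ?_
  induction hN : sortWeight w.1 using Nat.strong_induction_on generalizing w with
  | _ N ih =>
  subst hN
  by_cases hm : Monotone w.1
  · exact h w hm
  obtain ⟨j, hj⟩ : ∃ j, letR w.1 j < letL w.1 j := by
    by_contra! h
    exact hm (monotone_of_letL_le_letR h)
  have e := heckeT_smul_wordBasis_of_lt hX j ⟨swapWord j w.1, hX j w.1 w.2⟩ (by simpa using hj)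
  simp only [swapWord_swapWord] at e
  rw [← e, hf, hg, ih _ (sortWeight_swapWord_lt j w.1 hj) _ rfl]

variable [IsScalarTower ℂ (HeckeZero n)ᵐᵒᵖ N]

/-- A permutational module is presented by its nondecreasing words `v`, with the relations
`v · T_i = 0` whenever the letters in positions `i` and `i + 1` of `v` are equal. -/
theorem exists_wordModule_hom {X : Set (Fin n → ℕ)} (hX : SwapStable X) (a : (Fin n → ℕ) → N)
    (ha : ∀ v ∈ X, Monotone v → ∀ i : Fin (n - 1), letL v i = letR v i →
      op (heckeT i) • a v = 0) :
    ∃ f : WordModule hX →ₗ[ℂ] N,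
      (∀ (i : Fin (n - 1)) m, f (op (heckeT i) • m) = op (heckeT i) • f m) ∧
      ∀ w : X, Monotone w.1 → f (wordBasis hX w) = a w.1 := by
  have hU := isBraided_heckeT (n := n) N
  set U := fun (i : Fin (n - 1)) (m : N) => op (heckeT i) • m with hUdef
  refine ⟨wordLinearMap hX fun w => sortExt U a w.1, fun i m => ?_, fun w hw => ?_⟩
  · suffices (wordLinearMap hX fun w => sortExt U a w.1) ∘ₗ
        (DistribSMul.toLinearMap ℂ (WordModule hX) (op (heckeT i))) =
        (DistribSMul.toLinearMap ℂ N (op (heckeT i))) ∘ₗ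
          (wordLinearMap hX fun w => sortExt U a w.1) from
      LinearMap.congr_fun this m
    refine wordModule_linearMap_ext hX fun w => ?_
    simp only [LinearMap.comp_apply, DistribSMul.toLinearMap_apply, wordLinearMap_wordBasis]
    rcases lt_trichotomy (letL w.1 i) (letR w.1 i) with h | h | h
    · rw [heckeT_smul_wordBasis_of_lt hX i w h, wordLinearMap_wordBasis, sortExt_ascent hU _ _ _ h]
    · rw [heckeT_smul_wordBasis_of_eq hX i w h, map_zero]
      refine (sortExt_eq_letters hU (fun i => smul_zero _) a w.1 ?_ i h).symm
      rintro v ⟨π, rfl⟩ hv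
      exact ha _ (hX.comp_perm w.2 π) hv
    · rw [heckeT_smul_wordBasis_of_gt hX i w h, map_neg, wordLinearMap_wordBasis,
        sortExt_descent hU _ _ _ h, hUdef, heckeT_smul_sq]
  · rw [wordLinearMap_wordBasis, sortExt_of_monotone U a hw]

/-- Permutational modules are projective. -/
theorem wordModule_projective {X : Set (Fin n → ℕ)} (hX : SwapStable X) :
    Module.Projective (HeckeZero n)ᵐᵒᵖ (WordModule hX) := by
  classical
  refine Module.Projective.of_lifting_property fun {A B} _ _ _ _ p g hp => ?_
  -- The lifting problem involves bare modules over the algebra; scalars are restored through the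
  -- structure map.
  let _ : Module ℂ A := Module.compHom A (algebraMap ℂ (HeckeZero n)ᵐᵒᵖ)
  let _ : Module ℂ B := Module.compHom B (algebraMap ℂ (HeckeZero n)ᵐᵒᵖ)
  have _ : IsScalarTower ℂ (HeckeZero n)ᵐᵒᵖ A :=
    IsScalarTower.of_compHom _ _ _
  have _ : IsScalarTower ℂ (HeckeZero n)ᵐᵒᵖ B :=
    IsScalarTower.of_compHom _ _ _
  have key : ∀ v : Fin n → ℕ, ∃ x, ∀ hv : v ∈ X, p x = g (wordBasis hX ⟨v, hv⟩) ∧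
      ∀ i : Fin (n - 1), letL v i = letR v i → op (heckeT i) • x = 0 := by
    intro v
    by_cases hv : v ∈ X
    · obtain ⟨x, h1, h2⟩ := exists_lift_killed p hp {i | letL v i = letR v i}
        (g (wordBasis hX ⟨v, hv⟩)) fun i hi => by
          rw [← map_smul, heckeT_smul_wordBasis_of_eq hX i ⟨v, hv⟩ hi, map_zero]
      exact ⟨x, fun _ => ⟨h1, h2⟩⟩
    · exact ⟨0, fun h => absurd h hv⟩
  choose a ha using key
  obtain ⟨f, hf, hfa⟩ := exists_wordModule_hom hX a fun v hv _ i hi => (ha v hv).2 i hi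
  refine ⟨heckeHom f hf, ?_⟩
  have : (p.restrictScalars ℂ) ∘ₗ f = g.restrictScalars ℂ := by
    refine wordModule_hom_ext hX (fun i m => ?_) (fun i m => ?_) fun w hw => ?_
    · simp [hf]
    · simp
    · simp [hfa w hw, (ha w.1 w.2).1]
  exact LinearMap.ext fun m => LinearMap.congr_fun this m

end Projective

end

section

open MulOpposite

variable {n : ℕ}

/-! ### One-dimensional quotients -/

theorem exists_composition_isDescent (D : Set (Fin (n - 1))) :
    ∃ I : Composition n, ∀ i, IsDescent I i ↔ i ∈ D := by
  classical
  let c : CompositionAsSet n :=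
    ⟨Finset.univ.filter fun x : Fin (n + 1) => (x = 0 ∨ x = Fin.last n) ∨
      ∃ i ∈ D, (x : ℕ) = (i : ℕ) + 1, by simp, by simp⟩
  refine ⟨c.toComposition, fun i => ?_⟩
  rw [IsDescent, CompositionAsSet.toComposition_boundaries]
  simp only [c, Finset.mem_filter, Finset.mem_univ, true_and, Fin.ext_iff, Fin.val_zero,
    Fin.val_last, Nat.add_right_cancel_iff]
  constructor
  · rintro (h | ⟨j, hj, h⟩)
    · have := i.2
      omega
    · rwa [Fin.ext h]
  · exact fun h => Or.inr ⟨i, h, rfl⟩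

/-- The endpoints `0` and `n` belong to every boundary set, so only interior boundaries matter. -/
theorem boundaries_subset_iff {I J : Composition n} :
    J.boundaries ⊆ I.boundaries ↔ ∀ i, IsDescent J i → IsDescent I i := by
  refine ⟨fun h i hi => h hi, fun h x hx => ?_⟩
  rw [← Composition.toCompositionAsSet_boundaries] at *
  rcases Nat.eq_zero_or_pos (x : ℕ) with h0 | h0
  · rw [show x = 0 from Fin.ext h0]
    exact I.toCompositionAsSet.zero_mem
  rcases Nat.lt_or_ge (x : ℕ) n with h1 | h1
  · have e : x = ⟨(⟨(x : ℕ) - 1, by omega⟩ : Fin (n - 1)) + 1, by simp only; omega⟩ := by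
      ext
      simp only
      omega
    rw [e] at hx ⊢
    exact h _ hx
  · rw [show x = Fin.last n from Fin.ext (by simp only [Fin.val_last]; omega)]
    exact I.toCompositionAsSet.getLast_mem

theorem composition_eq_of_boundaries {I J : Composition n} (h : I.boundaries = J.boundaries) :
    I = J := by
  refine (compositionEquiv n).injective (CompositionAsSet.ext ?_)
  exact h

theorem composition_eq_of_isDescent {I J : Composition n}
    (h : ∀ i, IsDescent I i ↔ IsDescent J i) : I = J :=
  composition_eq_of_boundaries <| Finset.Subset.antisymm
    (boundaries_subset_iff.2 fun i => (h i).1) (boundaries_subset_iff.2 fun i => (h i).2)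

theorem composition_eq_of_simpleVal {I J : Composition n}
    (h : ∀ i, simpleVal I i = simpleVal J i) : I = J := by
  refine composition_eq_of_isDescent fun i => ?_
  have := h i
  simp only [simpleVal] at this
  split_ifs at this with h1 h2 h2 <;> simp_all

variable {M N : Type*} [AddCommGroup M] [Module (HeckeZero n)ᵐᵒᵖ M]
  [AddCommGroup N] [Module (HeckeZero n)ᵐᵒᵖ N]

section CharHom

variable [Module ℂ M]

/-- The space of linear forms on `M` on which `H_n(0)` acts through the character `φ_I`. -/
def charHom (M : Type*) [AddCommGroup M] [Module (HeckeZero n)ᵐᵒᵖ M] [Module ℂ M]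
    (I : Composition n) : Submodule ℂ (M →ₗ[ℂ] ℂ) where
  carrier := {h | ∀ (i : Fin (n - 1)) m, h (op (heckeT i) • m) = simpleVal I i * h m}
  add_mem' {f g} hf hg i m := by
    rw [LinearMap.add_apply, LinearMap.add_apply, hf i m, hg i m, mul_add]
  zero_mem' i m := by simp
  smul_mem' c f hf i m := by
    rw [LinearMap.smul_apply, LinearMap.smul_apply, hf i m, smul_eq_mul, smul_eq_mul]
    ring

variable [IsScalarTower ℂ (HeckeZero n)ᵐᵒᵖ M]

/-- The underlying vector space of `φ_I`. -/
def simpleEquiv (I : Composition n) : SimpleModule I ≃ₗ[ℂ] ℂ := LinearEquiv.refl ℂ ℂ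

theorem exists_charHom_of_simple {I : Composition n} (f : M →ₗ[(HeckeZero n)ᵐᵒᵖ] SimpleModule I) :
    ∃ h ∈ charHom M I, ∀ m, h m = simpleEquiv I (f m) := by
  refine ⟨(simpleEquiv I).toLinearMap ∘ₗ f.restrictScalars ℂ, fun i m => ?_, fun m => rfl⟩
  simp [heckeT_smul_simple]

theorem exists_simple_of_charHom {I : Composition n} {h : M →ₗ[ℂ] ℂ} (hh : h ∈ charHom M I) :
    ∃ f : M →ₗ[(HeckeZero n)ᵐᵒᵖ] SimpleModule I, ∀ m, simpleEquiv I (f m) = h m := by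
  refine ⟨heckeHom ((simpleEquiv I).symm.toLinearMap ∘ₗ h) fun i m => ?_, fun m => ?_⟩
  · simp [heckeT_smul_simple, hh i m, ← smul_eq_mul]
  · exact (simpleEquiv I).apply_symm_apply _

/-- A nonzero module has a nonzero morphism to some `φ_I`. -/
theorem exists_charHom_ne_zero [Nontrivial M] : ∃ (I : Composition n), ∃ h ∈ charHom M I, h ≠ 0 := by
  classical
  obtain ⟨x, hx⟩ := exists_ne (0 : M)
  obtain ⟨h0, hh0⟩ : ∃ h : M →ₗ[ℂ] ℂ, h x ≠ 0 := by
    by_contra! h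
    exact hx ((Module.forall_dual_apply_eq_zero_iff ℂ x).1 h)
  -- Precomposition reverses products, but the commutation and braid relations are invariant under
  -- reversal.
  let U : Fin (n - 1) → (M →ₗ[ℂ] ℂ) → (M →ₗ[ℂ] ℂ) :=
    fun i h => h ∘ₗ DistribSMul.toLinearMap ℂ M (op (heckeT i))
  have hUa : ∀ i h m, U i h m = h (op (heckeT i) • m) := fun i h m => rfl
  have hU : IsBraided U := by
    constructor
    · intro i j hij h
      ext m
      simp only [hUa]
      exact congrArg h ((isBraided_heckeT M).comm i j hij m).symm
    · intro i j hij h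
      ext m
      simp only [hUa]
      exact congrArg h ((isBraided_heckeT M).braid i j hij m)
  let Q : Set (Fin n → ℕ) := {w | Function.Injective w ∧ sortExt U (fun _ => h0) w ≠ 0}
  have hQ : Q.Nonempty := by
    refine ⟨fun i => i, fun i j h => Fin.ext h, ?_⟩
    rw [sortExt_of_monotone U _ (fun i j h => h)]
    rintro rfl
    exact hh0 rfl
  obtain ⟨w, ⟨hinj, hw⟩, hmin⟩ := exists_revWeight_minimal hQ
  -- At a descent of `w` the form lies in the image of `U_i`, where `U_i` acts by `-1`; at an ascent
  -- `U_i` kills it by minimality. So it spans a character whose descents are those of `w`.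
  obtain ⟨I, hI⟩ := exists_composition_isDescent {i | letR w i < letL w i}
  refine ⟨I, _, fun i m => ?_, hw⟩
  rw [← hUa]
  rcases lt_trichotomy (letL w i) (letR w i) with h | h | h
  · have hnd : ¬ IsDescent I i := fun hd => lt_asymm h ((hI i).1 hd)
    rw [← sortExt_ascent hU _ w i h, simpleVal, if_neg hnd, zero_mul]
    by_contra hne
    refine absurd (revWeight_swapWord_lt i w h) (not_lt.2 (hmin _ ?_))
    refine ⟨hinj.comp (Equiv.injective _), fun h0 => hne ?_⟩
    rw [h0, LinearMap.zero_apply]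
  · have := Fin.mk.inj_iff.1 (hinj h)
    omega
  · rw [simpleVal, if_pos ((hI i).2 h), sortExt_descent hU _ w i h]
    simp only [hUa, heckeT_smul_sq, map_neg, neg_one_mul]

end CharHom

/-! ### Decomposition of projective modules -/

theorem IsProjectiveCover.congr {I : Composition n} (h : IsProjectiveCover I M)
    (e : M ≃ₗ[(HeckeZero n)ᵐᵒᵖ] N) : IsProjectiveCover I N := by
  obtain ⟨hp, f, hf, hs⟩ := h
  refine ⟨Module.Projective.of_equiv e, f ∘ₗ e.symm.toLinearMap,
    hf.comp e.symm.surjective, fun L hL => ?_⟩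
  have h1 : L.comap e.toLinearMap ⊔ LinearMap.ker f = ⊤ := by
    rw [eq_top_iff]
    intro x _
    obtain ⟨y, hy, z, hz, hyz⟩ := Submodule.mem_sup.1 (hL ▸ Submodule.mem_top : e x ∈ _)
    refine Submodule.mem_sup.2 ⟨e.symm y, by simpa using hy, e.symm z, by simpa using hz, ?_⟩
    rw [← map_add, hyz, e.symm_apply_apply]
  have h2 := hs _ h1
  rw [eq_top_iff]
  intro x _
  have : e.symm x ∈ L.comap e.toLinearMap := h2 ▸ Submodule.mem_top
  simpa using this

theorem IsProjectiveCover.map {I : Composition n} {L : Submodule (HeckeZero n)ᵐᵒᵖ M}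
    (h : IsProjectiveCover I L) {i : M →ₗ[(HeckeZero n)ᵐᵒᵖ] N} (hi : Function.Injective i) :
    IsProjectiveCover I (L.map i) :=
  h.congr (Submodule.equivMapOfInjective i hi L)

theorem projective_of_isCompl [Module.Projective (HeckeZero n)ᵐᵒᵖ M]
    {K L : Submodule (HeckeZero n)ᵐᵒᵖ M} (h : IsCompl K L) :
    Module.Projective (HeckeZero n)ᵐᵒᵖ K :=
  Module.Projective.of_split K.subtype (Submodule.projectionOnto K L h)
    (LinearMap.ext fun x => Submodule.projectionOnto_apply_left h x)

variable [Module ℂ M] [IsScalarTower ℂ (HeckeZero n)ᵐᵒᵖ M]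

theorem finite_submodule [Module.Finite ℂ M] (L : Submodule (HeckeZero n)ᵐᵒᵖ M) :
    Module.Finite ℂ L :=
  Module.Finite.of_injective (L.subtype.restrictScalars ℂ) L.subtype_injective

theorem simple_surjective {I : Composition n} {f : M →ₗ[(HeckeZero n)ᵐᵒᵖ] SimpleModule I}
    {x : M} (hx : simpleEquiv I (f x) ≠ 0) : Function.Surjective f := by
  intro y
  refine ⟨(simpleEquiv I y / simpleEquiv I (f x)) • x, (simpleEquiv I).injective ?_⟩
  have := map_smul (f.restrictScalars ℂ) (simpleEquiv I y / simpleEquiv I (f x)) x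
  simp only [LinearMap.coe_restrictScalars] at this
  rw [this, map_smul, smul_eq_mul, div_mul_cancel₀ _ hx]

/-- A nonzero finite-dimensional projective module has a projective cover of some `φ_I` as a
direct summand. -/
theorem exists_cover_summand [Module.Finite ℂ M] [Nontrivial M]
    [Module.Projective (HeckeZero n)ᵐᵒᵖ M] :
    ∃ (I : Composition n) (K L : Submodule (HeckeZero n)ᵐᵒᵖ M), IsCompl K L ∧ L ≠ ⊥ ∧
      IsProjectiveCover I L := by
  have hA : IsArtinian (HeckeZero n)ᵐᵒᵖ M := isArtinian_of_tower ℂ inferInstance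
  have hN : IsNoetherian (HeckeZero n)ᵐᵒᵖ M := isNoetherian_of_tower ℂ inferInstance
  obtain ⟨I, h, hh, hne⟩ := exists_charHom_ne_zero (n := n) (M := M)
  obtain ⟨f, hf⟩ := exists_simple_of_charHom hh
  obtain ⟨x, hx⟩ : ∃ x, h x ≠ 0 := by
    by_contra! h'
    exact hne (LinearMap.ext h')
  rw [← hf] at hx
  -- The summand is the smallest image of an endomorphism preserving `f`. Powers of `e` still
  -- preserve `f`, so by minimality their images do not shrink, and Fitting's lemma makes this image
  -- a complement of a kernel.
  obtain ⟨_, ⟨e, he, rfl⟩, hmin⟩ := IsArtinian.set_has_minimal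
    {L : Submodule (HeckeZero n)ᵐᵒᵖ M | ∃ e : Module.End (HeckeZero n)ᵐᵒᵖ M,
      f ∘ₗ e = f ∧ L = LinearMap.range e} ⟨_, LinearMap.id, rfl, rfl⟩
  have hfe : ∀ m, f (e m) = f m := fun m => LinearMap.congr_fun he m
  have hpow : ∀ d : ℕ, f ∘ₗ (e ^ d) = f := by
    intro d
    induction d with
    | zero => rfl
    | succ d ih => rw [pow_succ', Module.End.mul_eq_comp, ← LinearMap.comp_assoc, he, ih]
  obtain ⟨d, hd⟩ := Filter.eventually_atTop.1 (LinearMap.eventually_isCompl_ker_pow_range_pow e)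
  have hc := hd (d + 1) (Nat.le_succ d)
  have hle : LinearMap.range (e ^ (d + 1)) ≤ LinearMap.range e := by
    rw [pow_succ']
    exact LinearMap.range_comp_le_range _ _
  have hr : LinearMap.range (e ^ (d + 1)) = LinearMap.range e :=
    eq_of_le_of_not_lt hle (hmin _ ⟨_, hpow _, rfl⟩)
  rw [hr] at hc
  have hfx : f (e x) ≠ 0 := fun h0 => hx (by rw [← hfe, h0, map_zero])
  refine ⟨I, _, _, hc, fun hb => hfx ?_, projective_of_isCompl hc.symm,
    f ∘ₗ (LinearMap.range e).subtype, ?_, fun L hL => ?_⟩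
  · have hex : e x ∈ LinearMap.range e := LinearMap.mem_range_self e x
    rw [hb, Submodule.mem_bot] at hex
    rw [hex, map_zero]
  · exact simple_surjective (x := (⟨e x, LinearMap.mem_range_self e x⟩ : LinearMap.range e))
      (by simpa [hfe] using hx)
  · have hs : Function.Surjective ((f ∘ₗ (LinearMap.range e).subtype) ∘ₗ L.subtype) := by
      intro y
      obtain ⟨z, hz⟩ := simple_surjective hx y
      obtain ⟨u, hu, v, hv, huv⟩ := Submodule.mem_sup.1
        (hL ▸ Submodule.mem_top : (⟨e z, LinearMap.mem_range_self e z⟩ : LinearMap.range e) ∈ _)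
      refine ⟨⟨u, hu⟩, ?_⟩
      have h1 := congrArg (f ∘ₗ (LinearMap.range e).subtype) huv
      rw [map_add, LinearMap.mem_ker.1 hv, add_zero] at h1
      refine h1.trans ?_
      simp [hfe, hz]
    -- Since `f` is already surjective on `L`, it lifts to a map from `M` into `L`; seen as an
    -- endomorphism of `M` this preserves `f`, so minimality forces `L` to be everything.
    obtain ⟨g, hg⟩ := Module.projective_lifting_property _ f hs
    have hmem : L.map (LinearMap.range e).subtype = LinearMap.range e := by
      have h1 : LinearMap.range ((LinearMap.range e).subtype ∘ₗ L.subtype ∘ₗ g) ≤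
          L.map (LinearMap.range e).subtype := by
        rintro _ ⟨y, rfl⟩
        exact ⟨g y, (g y).2, rfl⟩
      have h2 : L.map (LinearMap.range e).subtype ≤ LinearMap.range e :=
        Submodule.map_subtype_le _ _
      have h3 := eq_of_le_of_not_lt (h1.trans h2) (hmin _ ⟨_, hg, rfl⟩)
      exact le_antisymm h2 (h3.ge.trans h1)
    rw [eq_top_iff]
    rintro ⟨y, hy⟩ _
    rw [← hmem] at hy
    obtain ⟨⟨z, hz'⟩, hz, rfl⟩ := hy
    exact hz

/-- Stated for an injection `i`, so that a decomposition of a complement viewed as a module in its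
own right can be carried into `M`. -/
theorem isInternal_cons {R M K : Type*} [Ring R] [AddCommGroup M] [Module R M] [AddCommGroup K]
    [Module R K] {i : K →ₗ[R] M} (hinj : Function.Injective i) {m : ℕ} {L : Submodule R M}
    (h : IsCompl (LinearMap.range i) L) {N : Fin m → Submodule R K}
    (hN : DirectSum.IsInternal N) :
    DirectSum.IsInternal (Fin.cons L (fun j => (N j).map i) : Fin (m + 1) → Submodule R M) := by
  classical
  rw [DirectSum.isInternal_submodule_iff_iSupIndep_and_iSup_eq_top,
    iSupIndep_iff_finsetSum_eq_zero_imp_eq_zero] at *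
  obtain ⟨hi, ht⟩ := hN
  constructor
  · intro s v hv h0
    -- Extension by zero turns the relation over `s` into one over all indices, which can be split
    -- at index `0`.
    set u : Fin (m + 1) → M := fun i => if i ∈ s then v i else 0 with hu
    have hus : ∑ i, u i = 0 := by
      rw [← h0, hu, Finset.sum_ite_mem, Finset.univ_inter]
    have hu0 : u 0 ∈ L := by
      simp only [hu]
      split_ifs with hs
      · simpa using hv 0 hs
      · exact L.zero_mem
    have hu1 : ∀ j : Fin m, ∃ y ∈ N j, i y = u j.succ := by
      intro j
      simp only [hu]
      split_ifs with hs
      · simpa using hv j.succ hs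
      · exact ⟨0, (N j).zero_mem, map_zero i⟩
    choose y hyN hy using hu1
    rw [Fin.sum_univ_succ] at hus
    have hsum : ∑ j, u (Fin.succ j) = i (∑ j, y j) := by
      simp [← hy]
    have hu0K : u 0 ∈ LinearMap.range i := by
      rw [eq_neg_of_add_eq_zero_left hus, hsum, ← map_neg]
      exact LinearMap.mem_range_self _ _
    have e0 : u 0 = 0 := (Submodule.disjoint_def.1 h.disjoint) _ hu0K hu0
    rw [e0, zero_add, hsum, ← map_zero i] at hus
    have e1 : ∀ j, y j = 0 := fun j =>
      hi Finset.univ y (fun j _ => hyN j) (hinj hus) j (Finset.mem_univ j)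
    intro k hks
    have : u k = 0 := by
      refine Fin.cases e0 (fun j => ?_) k
      rw [← hy, e1, map_zero]
    simpa [hu, hks] using this
  · rw [eq_top_iff, ← h.sup_eq_top, sup_le_iff]
    constructor
    · rw [← Submodule.map_top, ← ht, Submodule.map_iSup, iSup_le_iff]
      intro j
      exact le_iSup_of_le j.succ (by simp)
    · exact le_iSup_of_le 0 (by simp)

/-- `M` is an internal direct sum of finitely many projective covers of modules `φ_I`. -/
def HasDecomposition (n : ℕ) (M : Type*) [AddCommGroup M] [Module (HeckeZero n)ᵐᵒᵖ M] : Prop :=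
  ∃ (m : ℕ) (N : Fin m → Submodule (HeckeZero n)ᵐᵒᵖ M) (I : Fin m → Composition n),
    DirectSum.IsInternal N ∧ ∀ j, IsProjectiveCover (I j) (N j)

theorem HasDecomposition.cons {M K : Type*} [AddCommGroup M] [Module (HeckeZero n)ᵐᵒᵖ M]
    [AddCommGroup K] [Module (HeckeZero n)ᵐᵒᵖ K] {i : K →ₗ[(HeckeZero n)ᵐᵒᵖ] M}
    (hinj : Function.Injective i) {L : Submodule (HeckeZero n)ᵐᵒᵖ M}
    (h : IsCompl (LinearMap.range i) L) {I : Composition n} (hL : IsProjectiveCover I L)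
    (hK : HasDecomposition n K) : HasDecomposition n M := by
  obtain ⟨m, N, J, hN, hJ⟩ := hK
  refine ⟨m + 1, _, Fin.cons I J, isInternal_cons hinj h hN, fun j => ?_⟩
  refine Fin.cases ?_ (fun j => ?_) j
  · exact hL
  · exact (hJ j).map hinj

/-- A finite-dimensional projective module is a direct sum of projective covers of the `φ_I`. -/
theorem exists_decomposition (d : ℕ) (M : Type*) [AddCommGroup M] [Module (HeckeZero n)ᵐᵒᵖ M]
    [Module ℂ M] [IsScalarTower ℂ (HeckeZero n)ᵐᵒᵖ M] [Module.Finite ℂ M]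
    [Module.Projective (HeckeZero n)ᵐᵒᵖ M] (hd : Module.finrank ℂ M ≤ d) :
    HasDecomposition n M := by
  induction d generalizing M with
  | zero =>
    have : Subsingleton M := Module.finrank_zero_iff.1 (Nat.le_zero.1 hd)
    refine ⟨0, Fin.elim0, Fin.elim0, ?_, fun j => j.elim0⟩
    rw [DirectSum.isInternal_submodule_iff_iSupIndep_and_iSup_eq_top]
    exact ⟨iSupIndep_subsingleton _, Subsingleton.elim _ _⟩
  | succ d ih =>
    rcases subsingleton_or_nontrivial M with hM | hM
    · refine ih M ?_
      rw [Module.finrank_zero_of_subsingleton]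
      exact Nat.zero_le d
    obtain ⟨I, K, L, hKL, hL, hc⟩ := exists_cover_summand (n := n) (M := M)
    have := projective_of_isCompl hKL
    have := finite_submodule K
    have := finite_submodule L
    have hlt : Module.finrank ℂ K < Module.finrank ℂ M := by
      refine Submodule.finrank_lt (s := K.restrictScalars ℂ) fun htop => hL ?_
      have hK : K = ⊤ := by
        rw [eq_top_iff]
        intro x _
        exact (htop ▸ Submodule.mem_top : x ∈ K.restrictScalars ℂ)
      exact eq_bot_of_top_isCompl (hK ▸ hKL)
    have hK := K.range_subtype
    exact (ih K (by omega)).cons K.subtype_injective (hK.symm ▸ hKL) hc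

end

section

open MulOpposite

variable {n : ℕ}

/-! ### Multiplicities -/

section

variable {M : Type*} [AddCommGroup M] [Module (HeckeZero n)ᵐᵒᵖ M]
  [Module ℂ M] [IsScalarTower ℂ (HeckeZero n)ᵐᵒᵖ M]

/-- A form `h` transforming by a character must vanish on the superfluous kernel: otherwise the
kernel of `h` and that of `f` would span the module, and `h` would be zero. Hence `h` is a multiple
of `f`, and a nonzero multiple has the same character. -/
theorem charHom_of_isProjectiveCover {I : Composition n} (hM : IsProjectiveCover I M) :
    ∃ f ∈ charHom M I, f ≠ 0 ∧ ∀ (J : Composition n), ∀ h ∈ charHom M J,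
      (∃ c : ℂ, h = c • f) ∧ (h ≠ 0 → I = J) := by
  obtain ⟨-, F, hF, hs⟩ := hM
  obtain ⟨f, hf, hfF⟩ := exists_charHom_of_simple F
  obtain ⟨x0, hx0⟩ := hF ((simpleEquiv I).symm 1)
  have hfx0 : f x0 = 1 := by rw [hfF, hx0, LinearEquiv.apply_symm_apply]
  refine ⟨f, hf, fun h0 => by simp [h0] at hfx0, fun J h hh => ?_⟩
  obtain ⟨H, hH⟩ := exists_simple_of_charHom hh
  have hker : ∀ x, f x = 0 → h x = 0 := by
    intro x hx
    by_contra hne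
    have htop : LinearMap.ker H ⊔ LinearMap.ker F = ⊤ := by
      rw [eq_top_iff]
      intro y _
      refine Submodule.mem_sup.2 ⟨y - (h y / h x) • x, ?_, (h y / h x) • x, ?_, by abel⟩
      · rw [LinearMap.mem_ker]
        apply (simpleEquiv J).injective
        rw [hH, map_sub, map_smul, smul_eq_mul, div_mul_cancel₀ _ hne, sub_self, map_zero]
      · rw [LinearMap.mem_ker]
        apply (simpleEquiv I).injective
        rw [← hfF, map_smul, hx, smul_zero, map_zero]
    have hx' : x ∈ LinearMap.ker H := hs _ htop ▸ Submodule.mem_top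
    rw [LinearMap.mem_ker] at hx'
    exact hne (by rw [← hH, hx', map_zero])
  have hhf : h = h x0 • f := by
    ext y
    have := hker (y - f y • x0) (by simp [hfx0])
    rw [map_sub, map_smul, sub_eq_zero] at this
    rw [this, LinearMap.smul_apply, smul_eq_mul, smul_eq_mul, mul_comm]
  refine ⟨⟨_, hhf⟩, fun hne => composition_eq_of_simpleVal fun i => ?_⟩
  have hc : h x0 ≠ 0 := fun h0 => hne (by rw [hhf, h0, zero_smul])
  have h1 := hh i x0
  have h2 := hf i x0
  rw [hhf, LinearMap.smul_apply, h2, LinearMap.smul_apply, hfx0] at h1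
  simp only [smul_eq_mul, mul_one] at h1
  rw [mul_comm] at h1
  exact mul_right_cancel₀ hc h1

open Classical in
theorem finrank_charHom_of_isProjectiveCover {I : Composition n} (hM : IsProjectiveCover I M)
    (J : Composition n) : Module.finrank ℂ (charHom M J) = if I = J then 1 else 0 := by
  obtain ⟨f, hf, hf0, hall⟩ := charHom_of_isProjectiveCover hM
  split_ifs with hIJ
  · subst hIJ
    have : charHom M I = Submodule.span ℂ {f} := by
      refine le_antisymm (fun h hh => ?_) ((Submodule.span_singleton_le_iff_mem _ _).2 hf)
      obtain ⟨c, hc⟩ := (hall I h hh).1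
      exact Submodule.mem_span_singleton.2 ⟨c, hc.symm⟩
    rw [this, finrank_span_singleton hf0]
  · have : charHom M J = ⊥ := by
      rw [eq_bot_iff]
      intro h hh
      by_contra hne
      exact hIJ ((hall J h hh).2 hne)
    rw [this, finrank_bot]

/-- The restriction of linear forms to submodules. -/
def charHomRestrict {m : ℕ} (N : Fin m → Submodule (HeckeZero n)ᵐᵒᵖ M) (J : Composition n) :
    charHom M J →ₗ[ℂ] ∀ j, charHom (N j) J where
  toFun h j := ⟨h.1 ∘ₗ (N j).subtype.restrictScalars ℂ, fun i m => h.2 i m⟩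
  map_add' _ _ := rfl
  map_smul' _ _ := rfl

/-- Equivariant forms on a direct sum are families of equivariant forms on the summands; this is
what makes multiplicities additive. -/
theorem charHomRestrict_bijective {m : ℕ} {N : Fin m → Submodule (HeckeZero n)ᵐᵒᵖ M}
    (hN : DirectSum.IsInternal N) (J : Composition n) :
    Function.Bijective (charHomRestrict N J) := by
  let e := LinearEquiv.ofBijective (DirectSum.coeLinearMap N) hN
  have he : ∀ j (x : N j), e (DirectSum.lof _ (Fin m) (fun j => N j) j x) = x := fun j x =>
    DirectSum.coeLinearMap_lof N j x
  constructor
  · rw [injective_iff_map_eq_zero]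
    intro h hh
    have h0 : ∀ j (x : N j), h.1 x = 0 := fun j x =>
      LinearMap.congr_fun (congrArg Subtype.val (congrFun hh j)) x
    refine Subtype.ext (LinearMap.ext fun x => ?_)
    obtain ⟨y, rfl⟩ := e.surjective x
    induction y using DirectSum.induction_on with
    | zero => simp
    | of j x => exact (congrArg h.1 (he j x)).trans (h0 j x)
    | add y z hy hz => rw [map_add, map_add, hy, hz]; simp
  · intro g
    let G : M →ₗ[ℂ] ℂ := ∑ j, (g j).1 ∘ₗ
      ((DirectSum.component (HeckeZero n)ᵐᵒᵖ (Fin m) (fun j => N j) j) ∘ₗ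
        e.symm.toLinearMap).restrictScalars ℂ
    have hG : ∀ x, G x = ∑ j, (g j).1 (e.symm x j) := by
      intro x
      simp only [G, LinearMap.sum_apply]
      rfl
    refine ⟨⟨G, fun i x => ?_⟩, ?_⟩
    · rw [hG, hG, Finset.mul_sum, map_smul]
      refine Finset.sum_congr rfl fun j _ => ?_
      exact (g j).2 i _
    · funext j
      refine Subtype.ext (LinearMap.ext fun x => ?_)
      change G x = (g j).1 x
      rw [hG, ← he, e.symm_apply_apply, Finset.sum_eq_single j]
      · rw [DirectSum.lof_eq_of, DirectSum.of_eq_same]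
      · intro k _ hk
        rw [DirectSum.lof_eq_of, DirectSum.of_eq_of_ne _ _ _ hk, map_zero]
      · exact fun hj => absurd (Finset.mem_univ j) hj

open Classical in
theorem finrank_charHom_of_decomposition [Module.Finite ℂ M] {m : ℕ}
    {N : Fin m → Submodule (HeckeZero n)ᵐᵒᵖ M} (hN : DirectSum.IsInternal N)
    {I : Fin m → Composition n} (hI : ∀ j, IsProjectiveCover (I j) (N j)) (J : Composition n) :
    Module.finrank ℂ (charHom M J) = ∑ j, if I j = J then 1 else 0 := by
  have := fun j => finite_submodule (N j)
  rw [(LinearEquiv.ofBijective _ (charHomRestrict_bijective hN J)).finrank_eq,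
    Module.finrank_pi_fintype]
  exact Finset.sum_congr rfl fun j _ => finrank_charHom_of_isProjectiveCover (hI j) J

/-- The characteristic of a finite-dimensional projective module is well defined. -/
theorem isCharacteristic_iff [Module.Finite ℂ M] [Module.Projective (HeckeZero n)ᵐᵒᵖ M]
    (c : NSym) : IsCharacteristic n M c ↔
      c = ∑ J : Composition n, Module.finrank ℂ (charHom M J) • ribbon J := by
  classical
  have key : ∀ {m : ℕ} {N : Fin m → Submodule (HeckeZero n)ᵐᵒᵖ M} {I : Fin m → Composition n},
      DirectSum.IsInternal N → (∀ j, IsProjectiveCover (I j) (N j)) →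
      ∑ J : Composition n, Module.finrank ℂ (charHom M J) • ribbon J = ∑ j, ribbon (I j) := by
    intro m N I hN hI
    simp only [finrank_charHom_of_decomposition hN hI, Finset.sum_smul]
    rw [Finset.sum_comm]
    refine Finset.sum_congr rfl fun j _ => ?_
    simp [ite_smul]
  constructor
  · rintro ⟨m, N, I, hN, hI, rfl⟩
    exact (key hN hI).symm
  · rintro rfl
    obtain ⟨m, N, I, hN, hI⟩ := exists_decomposition (n := n) _ M le_rfl
    exact ⟨m, N, I, hN, hI, key hN hI⟩

end

/-! ### Multiplicities in permutational modules. -/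

/-- The nondecreasing words of `X` having an ascent at each descent of `J`. -/
def ascentWords (X : Set (Fin n → ℕ)) (J : Composition n) : Set (Fin n → ℕ) :=
  {v | v ∈ X ∧ Monotone v ∧ ∀ i, IsDescent J i → letL v i < letR v i}

/-- By the presentation, a form is given by its values on nondecreasing words. An equality at
position `i` imposes `φ_J(T_i) · value = 0`: the value vanishes if `i` is a descent of `J` and is
free otherwise. -/
theorem finrank_charHom_wordModule {X : Set (Fin n → ℕ)} (hX : SwapStable X) (hfin : X.Finite)
    (J : Composition n) :
    Module.finrank ℂ (charHom (WordModule hX) J) = (ascentWords X J).ncard := by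
  classical
  let V := ascentWords X J
  have hV : V.Finite := hfin.subset fun v hv => hv.1
  have := hV.fintype
  let Φ : charHom (WordModule hX) J →ₗ[ℂ] (V → ℂ) :=
    { toFun := fun h v => h.1 (wordBasis hX ⟨v.1, v.2.1⟩)
      map_add' := fun h h' => rfl
      map_smul' := fun c h => rfl }
  have hΦ : Function.Bijective Φ := by
    constructor
    · rw [injective_iff_map_eq_zero]
      intro h hh
      refine Subtype.ext ?_
      obtain ⟨H, hH⟩ := exists_simple_of_charHom h.2
      have h0 : H.restrictScalars ℂ = 0 := by
        refine wordModule_hom_ext hX (fun i m => map_smul H _ m) (fun i m => by simp) fun w hw => ?_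
        apply (simpleEquiv J).injective
        rw [LinearMap.coe_restrictScalars, hH, LinearMap.zero_apply, map_zero]
        by_cases hwV : w.1 ∈ V
        · exact congrFun hh ⟨w.1, hwV⟩
        · have : ∃ i, IsDescent J i ∧ letL w.1 i = letR w.1 i := by
            by_contra! hcon
            exact hwV ⟨w.2, hw, fun i hi =>
              lt_of_le_of_ne (letL_le_letR_of_monotone hw i) (hcon i hi)⟩
          obtain ⟨i, hi, he⟩ := this
          have h1 := h.2 i (wordBasis hX w)
          rw [heckeT_smul_wordBasis_of_eq hX i w he, map_zero, simpleVal, if_pos hi] at h1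
          simpa using h1.symm
      ext x
      rw [← hH]
      exact congrArg (simpleEquiv J) (LinearMap.congr_fun h0 x)
    · intro a
      obtain ⟨f, hf, hfa⟩ := exists_wordModule_hom (N := SimpleModule J) hX
        (fun v => if hv : v ∈ V then (simpleEquiv J).symm (a ⟨v, hv⟩) else 0) (by
          intro v _ _ i hi
          split_ifs with hv
          · rw [heckeT_smul_simple, simpleVal, if_neg, zero_smul]
            exact fun hd => (hv.2.2 i hd).ne hi
          · rw [smul_zero])
      obtain ⟨h, hh, hhf⟩ := exists_charHom_of_simple (heckeHom f hf)
      refine ⟨⟨h, hh⟩, funext fun v => ?_⟩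
      change h _ = _
      rw [hhf]
      change simpleEquiv J (f _) = _
      rw [hfa _ v.2.2.1, dif_pos v.2, LinearEquiv.apply_symm_apply]
  rw [(LinearEquiv.ofBijective Φ hΦ).finrank_eq, Module.finrank_fintype_fun_eq_card,
    ← Nat.card_eq_fintype_card]
  exact Nat.card_coe_set_eq _

theorem wordModule_finite {X : Set (Fin n → ℕ)} (hX : SwapStable X) (hfin : X.Finite) :
    Module.Finite ℂ (WordModule hX) := by
  have := hfin.to_subtype
  exact inferInstanceAs (Module.Finite ℂ (X →₀ ℂ))

open Classical in
/-- The characteristic of a permutational module. -/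
theorem isCharacteristic_wordModule_iff {X : Set (Fin n → ℕ)} (hX : SwapStable X)
    (V : Finset (Fin n → ℕ)) (hfin : X.Finite) (hV : ∀ v, v ∈ V ↔ v ∈ X ∧ Monotone v) (c : NSym) :
    IsCharacteristic n (WordModule hX) c ↔
      c = ∑ v ∈ V, ∑ J : Composition n with ∀ i, IsDescent J i → letL v i < letR v i,
        ribbon J := by
  have := wordModule_finite hX hfin
  have := wordModule_projective hX
  have e : ∀ J, (ascentWords X J).ncard =
      (V.filter fun v => ∀ i, IsDescent J i → letL v i < letR v i).card := by
    intro J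
    rw [← Set.ncard_coe_finset]
    congr 1
    ext v
    simp [ascentWords, hV, and_assoc]
  rw [isCharacteristic_iff]
  simp only [finrank_charHom_wordModule hX hfin, e, Finset.card_filter, Finset.sum_smul,
    Finset.sum_filter]
  rw [Finset.sum_comm]
  simp only [ite_smul, one_smul, zero_smul]

end

section

variable {n : ℕ}

/-! ### Ribbons and complete functions -/

theorem exists_composition_boundaries {K : Composition n} {s : Finset (Fin (n + 1))}
    (h : K.boundaries ⊆ s) : ∃ J : Composition n, J.boundaries = s := by
  refine ⟨(⟨s, h K.toCompositionAsSet.zero_mem, h K.toCompositionAsSet.getLast_mem⟩ :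
    CompositionAsSet n).toComposition, ?_⟩
  rw [CompositionAsSet.toComposition_boundaries]

/-- Möbius inversion in a Boolean lattice: `J ↦ J.boundaries \ K.boundaries` identifies the interval
with a power set, whose alternating sum vanishes unless the set is empty. -/
theorem sum_interval_sign {K I : Composition n} (hKI : K.boundaries ⊆ I.boundaries) :
    ∑ J : Composition n with K.boundaries ⊆ J.boundaries ∧ J.boundaries ⊆ I.boundaries,
      (-1 : NSym) ^ (J.length - K.length) = if K = I then 1 else 0 := by
  have hcast := congrArg (Int.cast : ℤ → NSym)
    (Finset.sum_powerset_neg_one_pow_card (x := I.boundaries \ K.boundaries))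
  push_cast at hcast
  rw [show (if K = I then (1 : NSym) else 0) =
    if I.boundaries \ K.boundaries = ∅ then 1 else 0 from ?_, ← hcast]
  · refine Finset.sum_bij (fun J _ => J.boundaries \ K.boundaries) ?_ ?_ ?_ ?_
    · intro J hJ
      simp only [Finset.mem_filter, Finset.mem_univ, true_and] at hJ
      exact Finset.mem_powerset.2 (Finset.sdiff_subset_sdiff hJ.2 le_rfl)
    · intro J hJ J' hJ' h
      simp only [Finset.mem_filter, Finset.mem_univ, true_and] at hJ hJ'
      refine composition_eq_of_boundaries ?_
      rw [← Finset.sdiff_union_of_subset hJ.1, h, Finset.sdiff_union_of_subset hJ'.1]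
    · intro s hs
      obtain ⟨J, hJ⟩ := exists_composition_boundaries
        (Finset.subset_union_right : K.boundaries ⊆ s ∪ K.boundaries)
      have hs' := Finset.subset_sdiff.1 (Finset.mem_powerset.1 hs)
      refine ⟨J, ?_, ?_⟩
      · simp only [Finset.mem_filter, Finset.mem_univ, true_and, hJ]
        exact ⟨Finset.subset_union_right, Finset.union_subset hs'.1 hKI⟩
      · rw [hJ, Finset.union_sdiff_cancel_right hs'.2]
    · intro J hJ
      simp only [Finset.mem_filter, Finset.mem_univ, true_and] at hJ
      rw [Finset.card_sdiff_of_subset hJ.1, Composition.card_boundaries_eq_succ_length,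
        Composition.card_boundaries_eq_succ_length, Nat.add_sub_add_right]
  · congr 1
    rw [Finset.sdiff_eq_empty_iff_subset, eq_iff_iff]
    exact ⟨fun h => h ▸ subset_rfl, fun h => composition_eq_of_boundaries (hKI.antisymm h)⟩

/-- A complete function is the sum of the ribbons of the coarser compositions. -/
theorem sum_ribbon (I : Composition n) :
    ∑ J : Composition n with J.boundaries ⊆ I.boundaries, ribbon J = SProd I := by
  simp only [ribbon, Finset.sum_filter]
  have : ∀ J K : Composition n, (if J.boundaries ⊆ I.boundaries then
      (if K.boundaries ⊆ J.boundaries then (-1 : NSym) ^ (J.length - K.length) * SProd K else 0)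
      else 0) = (if K.boundaries ⊆ J.boundaries ∧ J.boundaries ⊆ I.boundaries then
        (-1 : NSym) ^ (J.length - K.length) else 0) * SProd K := by
    intro J K
    split_ifs <;> simp_all
  have h2 : ∀ J : Composition n, (if J.boundaries ⊆ I.boundaries then
      ∑ K : Composition n, (if K.boundaries ⊆ J.boundaries then
        (-1 : NSym) ^ (J.length - K.length) * SProd K else 0) else 0) =
      ∑ K : Composition n, (if K.boundaries ⊆ J.boundaries ∧ J.boundaries ⊆ I.boundaries then
        (-1 : NSym) ^ (J.length - K.length) else 0) * SProd K := by
    intro J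
    rw [← Finset.sum_congr rfl fun K _ => this J K]
    split_ifs <;> simp
  rw [Finset.sum_congr rfl fun J _ => h2 J, Finset.sum_comm, Finset.sum_eq_single I]
  · rw [← Finset.sum_mul, ← Finset.sum_filter, sum_interval_sign subset_rfl, if_pos rfl, one_mul]
  · intro K _ hK
    rw [← Finset.sum_mul, ← Finset.sum_filter]
    by_cases hKI : K.boundaries ⊆ I.boundaries
    · rw [sum_interval_sign hKI, if_neg hK, zero_mul]
    · rw [Finset.filter_false_of_mem, Finset.sum_empty, zero_mul]
      exact fun J _ h => hKI (h.1.trans h.2)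
  · exact fun h => absurd (Finset.mem_univ I) h

/-! ### The weight of a nondecreasing word -/

/-- The number of occurrences of the letters `1, …, m` in `v`. -/
def letterCounts (m : ℕ) (v : Fin n → ℕ) : List ℕ :=
  (List.range m).map fun c => (Finset.univ.filter fun i => v i = c + 1).card

/-- The product `S_{i_1} ⋯ S_{i_m}`, where `i_c` is the number of occurrences of `c` in `v`. -/
def wt (m : ℕ) (v : Fin n → ℕ) : NSym := ((letterCounts m v).map S).prod

/-- This holds also for `c > m`: the list is exhausted, and all letters are at most `m`. -/
theorem sum_take_letterCounts (m c : ℕ) (v : Fin n → ℕ) (hv : ∀ i, 1 ≤ v i ∧ v i ≤ m) :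
    ((letterCounts m v).take c).sum = (Finset.univ.filter fun i => v i ≤ c).card := by
  have key : ∀ c, ((List.range c).map
      fun c => (Finset.univ.filter fun i => v i = c + 1).card).sum =
      (Finset.univ.filter fun i => v i ≤ c).card := by
    intro c
    induction c with
    | zero =>
      symm
      simp only [List.range_zero, List.map_nil, List.sum_nil, Finset.card_eq_zero]
      refine Finset.filter_false_of_mem fun i _ => ?_
      have := (hv i).1
      omega
    | succ c ih =>
      rw [List.range_succ, List.map_append, List.sum_append, ih]
      simp only [List.map_cons, List.map_nil, List.sum_cons, List.sum_nil, add_zero]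
      rw [← Finset.card_union_of_disjoint]
      · congr 1
        ext i
        simp only [Finset.mem_union, Finset.mem_filter, Finset.mem_univ, true_and]
        omega
      · refine Finset.disjoint_filter.2 fun i _ h => ?_
        omega
  rw [letterCounts, ← List.map_take, List.take_range, key]
  congr 1
  ext i
  have := (hv i).2
  simp only [Finset.mem_filter, Finset.mem_univ, true_and]
  omega

/-- Letters that do not occur give zero counts, which a composition cannot contain; removing them
changes no partial sum. -/
theorem exists_take_filter_sum (l : List ℕ) (x : ℕ) :
    (∃ j, ((l.filter (0 < ·)).take j).sum = x) ↔ ∃ j, (l.take j).sum = x := by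
  induction l generalizing x with
  | nil => simp
  | cons a l ih =>
    have h1 : ∀ (a : ℕ) (l : List ℕ), (∃ j, ((a :: l).take j).sum = x) ↔
        x = 0 ∨ ∃ j, a + (l.take j).sum = x := by
      intro a l
      constructor
      · rintro ⟨j, hj⟩
        cases j with
        | zero => exact Or.inl (by simpa using hj.symm)
        | succ j => exact Or.inr ⟨j, by simpa using hj⟩
      · rintro (h | ⟨j, hj⟩)
        · exact ⟨0, by simp [h]⟩
        · exact ⟨j + 1, by simpa using hj⟩
    have h2 : ∀ (l : List ℕ), (∃ j, a + (l.take j).sum = x) ↔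
        a ≤ x ∧ ∃ j, (l.take j).sum = x - a := by
      intro l
      constructor
      · rintro ⟨j, hj⟩
        exact ⟨by omega, j, by omega⟩
      · rintro ⟨h, j, hj⟩
        exact ⟨j, by omega⟩
    rcases Nat.eq_zero_or_pos a with rfl | ha
    · rw [List.filter_cons_of_neg (by simp), ih, h1]
      simp only [zero_add]
      refine ⟨Or.inr, ?_⟩
      rintro (h | h)
      · exact ⟨0, by simp [h]⟩
      · exact h
    · rw [List.filter_cons_of_pos (by simpa using ha), h1, h1, h2, h2, ih]

/-- The composition of `n` given by the nonzero numbers of occurrences of letters of `v`. -/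
def wordComposition (m : ℕ) (v : Fin n → ℕ) (hv : ∀ i, 1 ≤ v i ∧ v i ≤ m) : Composition n where
  blocks := (letterCounts m v).filter (0 < ·)
  blocks_pos h := by simpa using (List.mem_filter.1 h).2
  blocks_sum := by
    have h1 : ∀ l : List ℕ, (l.filter (0 < ·)).sum = l.sum := by
      intro l
      induction l with
      | nil => rfl
      | cons a l ih =>
        rcases Nat.eq_zero_or_pos a with rfl | ha
        · rw [List.filter_cons_of_neg (by simp), ih, List.sum_cons, zero_add]
        · rw [List.filter_cons_of_pos (by simpa using ha), List.sum_cons, List.sum_cons, ih]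
    rw [h1]
    have h2 := sum_take_letterCounts m m v hv
    rw [List.take_of_length_le (by simp [letterCounts])] at h2
    rw [h2, Finset.filter_true_of_mem fun i _ => (hv i).2, Finset.card_univ, Fintype.card_fin]

theorem SProd_wordComposition (m : ℕ) (v : Fin n → ℕ) (hv : ∀ i, 1 ≤ v i ∧ v i ≤ m) :
    SProd (wordComposition m v hv) = wt m v := by
  have h1 : ∀ l : List ℕ, ((l.filter (0 < ·)).map S).prod = (l.map S).prod := by
    intro l
    induction l with
    | nil => rfl
    | cons a l ih =>
      rcases Nat.eq_zero_or_pos a with rfl | ha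
      · rw [List.filter_cons_of_neg (by simp), ih, List.map_cons, List.prod_cons]
        simp [S]
      · rw [List.filter_cons_of_pos (by simpa using ha), List.map_cons, List.map_cons,
          List.prod_cons, List.prod_cons, ih]
  exact h1 _

theorem mem_boundaries_iff (I : Composition n) (x : Fin (n + 1)) :
    x ∈ I.boundaries ↔ ∃ j, (I.blocks.take j).sum = x := by
  simp only [Composition.boundaries, Finset.mem_map, Finset.mem_univ, true_and]
  constructor
  · rintro ⟨j, rfl⟩
    exact ⟨j, rfl⟩
  · rintro ⟨j, hj⟩
    rcases Nat.lt_or_ge j (I.length + 1) with h | h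
    · exact ⟨⟨j, h⟩, Fin.ext hj⟩
    · refine ⟨Fin.last _, Fin.ext ?_⟩
      rw [← hj]
      have h1 : I.blocks.take j = I.blocks := List.take_of_length_le (by
        change I.length ≤ j
        omega)
      rw [h1, I.blocks_sum]
      simp [Composition.boundary]

/-- In a nondecreasing word the letters at most `c` form an initial segment. Its end never separates
two equal letters, and at a strict ascent the choice `c = letL v i` ends it there. -/
theorem exists_card_le_iff {v : Fin n → ℕ} (hm : Monotone v) (i : Fin (n - 1)) :
    (∃ c, (Finset.univ.filter fun j => v j ≤ c).card = (i : ℕ) + 1) ↔ letL v i < letR v i := by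
  constructor
  · rintro ⟨c, hc⟩
    by_contra hlt
    have heq := le_antisymm (letL_le_letR_of_monotone hm i) (not_lt.1 hlt)
    rcases Nat.lt_or_ge c (letL v i) with h | h
    · have : (Finset.univ.filter fun j => v j ≤ c) ⊆
          Finset.Iio (⟨(i : ℕ), by omega⟩ : Fin n) := by
        intro j hj
        rw [Finset.mem_Iio]
        by_contra hji
        have h1 := hm (not_lt.1 hji)
        have h2 := (Finset.mem_filter.1 hj).2
        simp only [letL] at h
        omega
      have := Finset.card_le_card this
      rw [hc, Fin.card_Iio] at this
      simp only at this
      omega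
    · have : Finset.Iic (⟨(i : ℕ) + 1, by omega⟩ : Fin n) ⊆
          Finset.univ.filter fun j => v j ≤ c := by
        intro j hj
        have h1 := hm (Finset.mem_Iic.1 hj)
        simp only [Finset.mem_filter, Finset.mem_univ, true_and]
        rw [heq] at h
        exact h1.trans h
      have := Finset.card_le_card this
      rw [hc, Fin.card_Iic] at this
      simp only at this
      omega
  · intro h
    refine ⟨letL v i, ?_⟩
    have : (Finset.univ.filter fun j => v j ≤ letL v i) =
        Finset.Iic (⟨(i : ℕ), by omega⟩ : Fin n) := by
      ext j
      simp only [Finset.mem_filter, Finset.mem_univ, true_and, Finset.mem_Iic]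
      refine ⟨fun hj => ?_, fun hj => hm hj⟩
      by_contra hji
      have h1 : (⟨(i : ℕ) + 1, by omega⟩ : Fin n) ≤ j := by
        rw [Fin.le_def] at hji ⊢
        simp only at hji ⊢
        omega
      have h2 := hm h1
      exact absurd (h2.trans hj) (not_le.2 h)
    rw [this, Fin.card_Iic]

theorem isDescent_wordComposition (m : ℕ) {v : Fin n → ℕ} (hv : ∀ i, 1 ≤ v i ∧ v i ≤ m)
    (hm : Monotone v) (i : Fin (n - 1)) :
    IsDescent (wordComposition m v hv) i ↔ letL v i < letR v i := by
  rw [IsDescent, mem_boundaries_iff, ← exists_card_le_iff hm]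
  refine (exists_take_filter_sum _ _).trans ?_
  simp only [sum_take_letterCounts m _ v hv]

-- The ascents of `v` are the descents of its multiplicity composition, so the condition on `J` is
-- refinement order and `sum_ribbon` applies.
open Classical in
theorem sum_ribbon_ascents (m : ℕ) {v : Fin n → ℕ} (hv : ∀ i, 1 ≤ v i ∧ v i ≤ m)
    (hm : Monotone v) :
    ∑ J : Composition n with ∀ i, IsDescent J i → letL v i < letR v i, ribbon J = wt m v := by
  rw [← SProd_wordComposition m v hv, ← sum_ribbon]
  refine Finset.sum_congr (Finset.filter_congr fun J _ => ?_) fun _ _ => rfl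
  simp only [boundaries_subset_iff, isDescent_wordComposition m hv hm]

end

section

variable {n : ℕ}

/-! ### Sums over nondecreasing words -/

open Classical in
/-- The nondecreasing words of length `n` over `{1, …, m}`. -/
def words (n m : ℕ) : Finset (Fin n → ℕ) :=
  (Fintype.piFinset fun _ => Finset.Icc 1 m).filter Monotone

theorem mem_words {m : ℕ} {v : Fin n → ℕ} :
    v ∈ words n m ↔ (∀ i, 1 ≤ v i ∧ v i ≤ m) ∧ Monotone v := by
  simp [words]

/-- The sum of the weights of the nondecreasing words of length `n` over `{1, …, m}`. -/
def wordSum (n m : ℕ) : NSym := ∑ v ∈ words n m, wt m v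

theorem letterCounts_append {a b : ℕ} (p q : ℕ) {u : Fin a → ℕ} {w : Fin b → ℕ}
    (hu : ∀ i, u i ≤ p) (hw : ∀ i, 1 ≤ w i) :
    letterCounts (p + q) (Fin.append u fun i => p + w i) =
      letterCounts p u ++ letterCounts q w := by
  rw [letterCounts, List.range_add, List.map_append, List.map_map]
  congr 1
  · refine List.map_congr_left fun c hc => ?_
    have hc := List.mem_range.1 hc
    simp only [Finset.card_filter, Fin.sum_univ_add, Fin.append_left, Fin.append_right]
    rw [Nat.add_eq_left]
    refine Finset.sum_eq_zero fun i _ => if_neg ?_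
    have := hw i
    omega
  · refine List.map_congr_left fun c _ => ?_
    simp only [Function.comp, Finset.card_filter, Fin.sum_univ_add, Fin.append_left,
      Fin.append_right]
    rw [Finset.sum_eq_zero fun i _ => if_neg ?_, zero_add]
    · refine Finset.sum_congr rfl fun i _ => if_congr ?_ rfl rfl
      omega
    · have := hu i
      omega

theorem wt_append {a b : ℕ} (p q : ℕ) {u : Fin a → ℕ} {w : Fin b → ℕ}
    (hu : ∀ i, u i ≤ p) (hw : ∀ i, 1 ≤ w i) :
    wt (p + q) (Fin.append u fun i => p + w i) = wt p u * wt q w := by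
  rw [wt, letterCounts_append p q hu hw, List.map_append, List.prod_append, wt, wt]

theorem monotone_append {a b : ℕ} {p : ℕ} {u : Fin a → ℕ} {w : Fin b → ℕ}
    (hu : ∀ i, u i ≤ p) (hum : Monotone u) (hwm : Monotone w) :
    Monotone (Fin.append u fun i => p + w i) := by
  intro i j
  refine Fin.addCases (fun i => ?_) (fun i => ?_) i <;>
    refine Fin.addCases (fun j => ?_) (fun j => ?_) j <;>
    simp only [Fin.append_left, Fin.append_right, Fin.le_def, Fin.val_castAdd, Fin.val_natAdd] <;>
    intro h
  · exact hum (Fin.le_def.2 h)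
  · exact (hu i).trans (Nat.le_add_right _ _)
  · omega
  · exact Nat.add_le_add_left (hwm (Fin.le_def.2 (by omega))) _

/-- Lowering the last `b` letters by `p` gives a bijection with pairs of words on disjoint
alphabets; the weight is multiplicative because the letters up to `p` precede the others. -/
theorem sum_words_append (a b p q : ℕ) (Q : (Fin a → ℕ) → Prop) [DecidablePred Q]
    [DecidablePred fun v : Fin (a + b) → ℕ => Q (fun i => v (Fin.castAdd b i)) ∧
      (∀ i, v (Fin.castAdd b i) ≤ p) ∧ ∀ i, p < v (Fin.natAdd a i)] :
    ∑ v ∈ words (a + b) (p + q) with Q (fun i => v (Fin.castAdd b i)) ∧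
      (∀ i, v (Fin.castAdd b i) ≤ p) ∧ ∀ i, p < v (Fin.natAdd a i), wt (p + q) v =
    (∑ u ∈ words a p with Q u, wt p u) * wordSum b q := by
  rw [wordSum, Finset.sum_mul_sum, ← Finset.sum_product']
  symm
  refine Finset.sum_bij' (fun x _ => Fin.append x.1 fun i => p + x.2 i)
    (fun v _ => (fun i => v (Fin.castAdd b i), fun i => v (Fin.natAdd a i) - p)) ?_ ?_ ?_ ?_ ?_
  · rintro ⟨u, w⟩ h
    simp only [Finset.mem_product, Finset.mem_filter, mem_words] at h
    obtain ⟨⟨⟨hu1, hum⟩, hQ⟩, hw1, hwm⟩ := h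
    simp only [Finset.mem_filter, mem_words, Fin.append_left, Fin.append_right]
    refine ⟨⟨fun i => ?_, monotone_append (fun i => (hu1 i).2) hum hwm⟩, hQ,
      fun i => (hu1 i).2, fun i => ?_⟩
    · refine Fin.addCases (fun i => ?_) (fun i => ?_) i
      · rw [Fin.append_left]
        have := hu1 i
        omega
      · rw [Fin.append_right]
        have := hw1 i
        omega
    · have := hw1 i
      omega
  · intro v h
    simp only [Finset.mem_filter, mem_words] at h
    obtain ⟨⟨hv1, hvm⟩, hQ, h1, h2⟩ := h
    simp only [Finset.mem_product, Finset.mem_filter, mem_words]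
    refine ⟨⟨⟨fun i => ⟨(hv1 _).1, h1 i⟩, fun i j hij => hvm (Fin.le_def.2 hij)⟩, hQ⟩,
      fun i => ?_, fun i j hij => ?_⟩
    · have := h2 i
      have := (hv1 (Fin.natAdd a i)).2
      omega
    · exact Nat.sub_le_sub_right (hvm (Fin.le_def.2 (Nat.add_le_add_left hij a))) _
  · rintro ⟨u, w⟩ h
    simp
  · intro v h
    simp only [Finset.mem_filter, mem_words] at h
    obtain ⟨-, -, -, h2⟩ := h
    funext i
    refine Fin.addCases (fun i => ?_) (fun i => ?_) i
    · rw [Fin.append_left]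
    · rw [Fin.append_right]
      exact Nat.add_sub_of_le (h2 i).le
  · rintro ⟨u, w⟩ h
    simp only [Finset.mem_product, Finset.mem_filter, mem_words] at h
    exact (wt_append p q (fun i => (h.1.1.1 i).2) fun i => (h.2.1 i).1).symm

/-- The cut `a` is the first position whose letter exceeds `τ a`, or `n` if there is none; later
letters exceed `τ a` too since `v` is nondecreasing. -/
theorem exists_unique_split (τ : ℕ → ℕ) {v : Fin n → ℕ} (hv : Monotone v) :
    ∃! ab, ab ∈ Finset.HasAntidiagonal.antidiagonal n ∧ (∀ i : Fin n, (i : ℕ) < ab.1 → v i ≤ τ i) ∧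
      ∀ i : Fin n, ab.1 ≤ i → τ ab.1 < v i := by
  classical
  have hex : ∃ a, a = n ∨ ∃ h : a < n, τ a < v ⟨a, h⟩ := ⟨n, Or.inl rfl⟩
  have hle : Nat.find hex ≤ n := Nat.find_min' hex (Or.inl rfl)
  refine ⟨(Nat.find hex, n - Nat.find hex), ⟨?_, ?_, ?_⟩, ?_⟩
  · rw [Finset.HasAntidiagonal.mem_antidiagonal]
    exact Nat.add_sub_of_le hle
  · intro i hi
    have := Nat.find_min hex hi
    push Not at this
    exact this.2 i.2
  · intro i hi
    rcases Nat.find_spec hex with h | ⟨h, h'⟩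
    · have := i.2
      simp only at hi
      omega
    · exact h'.trans_le (hv (Fin.le_def.2 hi))
  · rintro ⟨a, b⟩ ⟨hab, h1, h2⟩
    rw [Finset.HasAntidiagonal.mem_antidiagonal] at hab
    simp only at hab h1 h2
    have e : a = Nat.find hex := by
      symm
      rw [Nat.find_eq_iff]
      constructor
      · rcases Nat.lt_or_ge a n with h | h
        · exact Or.inr ⟨h, h2 ⟨a, h⟩ le_rfl⟩
        · exact Or.inl (by omega)
      · rintro c hc (h | ⟨h, h'⟩)
        · omega
        · exact absurd (h1 ⟨c, h⟩ hc) (not_le.2 h')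
    rw [Prod.mk.injEq]
    omega

open Classical in
/-- Nondecreasing words are cut at the first position `a` where the letter exceeds `τ a`. -/
theorem wordSum_split (n M : ℕ) {τ : ℕ → ℕ} (hτ : Monotone τ) (hM : τ n ≤ M) :
    wordSum n M = ∑ ab ∈ Finset.HasAntidiagonal.antidiagonal n,
      (∑ u ∈ words ab.1 (τ ab.1) with ∀ i : Fin ab.1, u i ≤ τ i, wt (τ ab.1) u) *
        wordSum ab.2 (M - τ ab.1) := by
  have h1 : wordSum n M = ∑ ab ∈ Finset.HasAntidiagonal.antidiagonal n, ∑ v ∈ words n M with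
      (∀ i : Fin n, (i : ℕ) < ab.1 → v i ≤ τ i) ∧ ∀ i : Fin n, ab.1 ≤ i → τ ab.1 < v i,
        wt M v := by
    simp only [Finset.sum_filter]
    rw [Finset.sum_comm, wordSum]
    refine Finset.sum_congr rfl fun v hv => ?_
    obtain ⟨ab, ⟨hab, hP⟩, huniq⟩ := exists_unique_split τ (mem_words.1 hv).2
    rw [Finset.sum_eq_single ab, if_pos hP]
    · exact fun cd hcd hne => if_neg fun h => hne (huniq cd ⟨hcd, h⟩)
    · exact fun h => absurd hab h
  rw [h1]
  refine Finset.sum_congr rfl ?_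
  rintro ⟨a, b⟩ hab
  obtain rfl : a + b = n := Finset.HasAntidiagonal.mem_antidiagonal.1 hab
  obtain ⟨q, rfl⟩ : ∃ q, M = τ a + q :=
    Nat.exists_eq_add_of_le ((hτ (Nat.le_add_right a b)).trans hM)
  simp only [Nat.add_sub_cancel_left]
  rw [← sum_words_append a b (τ a) q fun u => ∀ i : Fin a, u i ≤ τ i]
  refine Finset.sum_congr (Finset.filter_congr fun v _ => ?_) fun _ _ => rfl
  constructor
  · rintro ⟨h2, h3⟩
    -- Monotonicity of `τ` bounds every letter before the cut by `τ a`, so the prefix fits in the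
    -- alphabet `{1, …, τ a}`.
    refine ⟨fun i => h2 _ i.2, fun i => (h2 _ i.2).trans (hτ i.2.le), fun i => h3 _ ?_⟩
    simp
  · rintro ⟨h2, -, h3⟩
    constructor
    · intro i hi
      exact h2 ⟨i, hi⟩
    · intro i hi
      have := h3 ⟨i - a, by omega⟩
      convert this using 2
      ext
      simp only [Fin.val_natAdd]
      omega

theorem S_zero : S 0 = 1 := by simp [S]

theorem wordSum_one (n : ℕ) : wordSum n 1 = S n := by
  have : words n 1 = {fun _ => 1} := by
    ext v
    rw [mem_words, Finset.mem_singleton]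
    constructor
    · rintro ⟨h, -⟩
      funext i
      have := h i
      omega
    · rintro rfl
      exact ⟨fun i => ⟨le_rfl, le_rfl⟩, monotone_const⟩
  rw [wordSum, this, Finset.sum_singleton]
  simp [wt, letterCounts]

theorem wordSum_zero (n : ℕ) : wordSum n 0 = if n = 0 then 1 else 0 := by
  split_ifs with h
  · subst h
    have : words 0 0 = {fun _ => 1} := by
      ext v
      rw [mem_words, Finset.mem_singleton]
      exact ⟨fun _ => Subsingleton.elim _ _, fun _ => ⟨fun i => i.elim0, fun i => i.elim0⟩⟩
    rw [wordSum, this, Finset.sum_singleton]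
    simp [wt, letterCounts]
  · have : words n 0 = ∅ := by
      refine Finset.eq_empty_of_forall_notMem fun v hv => ?_
      have := (mem_words.1 hv).1 ⟨0, Nat.pos_of_ne_zero h⟩
      omega
    rw [wordSum, this, Finset.sum_empty]

/-- With the constant threshold `m`, the cut separates the final run of letters `m + 1`. -/
theorem wordSum_succ (n m : ℕ) :
    wordSum n (m + 1) = ∑ ab ∈ Finset.HasAntidiagonal.antidiagonal n, wordSum ab.1 m * S ab.2 := by
  classical
  rw [wordSum_split n (m + 1) (τ := fun _ => m) monotone_const (Nat.le_succ m)]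
  refine Finset.sum_congr rfl fun ab _ => ?_
  rw [Nat.add_sub_cancel_left, wordSum_one, Finset.filter_true_of_mem, wordSum]
  exact fun u hu i => ((mem_words.1 hu).1 i).2

/-! ### The functional equation -/

theorem coe_sigma : ((sigma : NSym⟦X⟧ˣ) : NSym⟦X⟧) = PowerSeries.mk S := rfl

theorem SMul_add_one (m : ℤ) (n : ℕ) :
    SMul (m + 1) n = ∑ ab ∈ Finset.HasAntidiagonal.antidiagonal n, SMul m ab.1 * S ab.2 := by
  simp only [SMul, zpow_add_one, Units.val_mul, coeff_mul, coe_sigma, coeff_mk]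

theorem SMul_natCast (m n : ℕ) : SMul m n = wordSum n m := by
  induction m generalizing n with
  | zero => simp [SMul, wordSum_zero, coeff_one]
  | succ m ih =>
    rw [Nat.cast_succ, SMul_add_one, wordSum_succ]
    simp only [ih]

open Classical in
/-- The sum of the weights of the nondecreasing `(k,l)`-parking functions of length `n`. -/
def parkingSum (k l n : ℕ) : NSym :=
  ∑ u ∈ words n (l + n * k) with ∀ i : Fin n, u i ≤ l + i * k, wt (l + n * k) u

/-- The cut with threshold `l + ik` over an alphabet of `l + nk` letters: the prefix is a parking
function, and for `a + b = n` exactly `bk` letters remain available after the cut. -/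
theorem SMul_eq_sum_parkingSum (k l n : ℕ) :
    SMul (n * k + l) n = ∑ ab ∈ Finset.HasAntidiagonal.antidiagonal n,
      parkingSum k l ab.1 * SMul (ab.2 * k) ab.2 := by
  have hτ : Monotone fun i => l + i * k := fun i j h =>
    Nat.add_le_add_left (Nat.mul_le_mul_right k h) l
  have := wordSum_split n (l + n * k) hτ le_rfl
  rw [← SMul_natCast] at this
  rw [show (n * k + l : ℤ) = ((l + n * k : ℕ) : ℤ) by push_cast; ring, this]
  refine Finset.sum_congr rfl fun ab hab => ?_
  rw [← Finset.HasAntidiagonal.mem_antidiagonal.1 hab, parkingSum, add_mul, ← add_assoc,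
    Nat.add_sub_cancel_left,
    ← SMul_natCast, Nat.cast_mul]

/-- The defect of the functional equation in degree `n`. -/
def defect (k l n : ℕ) (r : ℤ) : NSym :=
  SMul (n * k + r) n - ∑ ab ∈ Finset.HasAntidiagonal.antidiagonal n,
    parkingSum k l ab.1 * SMul (ab.2 * k + (r - l)) ab.2

/-- Raising `r` by one multiplies each `σ_t(A)`-power by `σ_t(A)` on the right. Extracting `S_b`
lowers the degree to `a = n - b` without changing the exponent, whence the shift `nk + r = ak + (r +
bk)`. -/
theorem defect_add_one (k l n : ℕ) (r : ℤ) :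
    defect k l n (r + 1) =
      ∑ ab ∈ Finset.HasAntidiagonal.antidiagonal n, defect k l ab.1 (r + ab.2 * k) * S ab.2 := by
  simp only [defect, sub_mul, Finset.sum_sub_distrib]
  congr 1
  · rw [← add_assoc, SMul_add_one]
    refine Finset.sum_congr rfl fun ab hab => ?_
    rw [← Finset.HasAntidiagonal.mem_antidiagonal.1 hab]
    congr 2
    push_cast
    ring
  · have h1 : ∀ e : ℕ, (e * k + (r + 1 - l) : ℤ) = (e * k + (r - l)) + 1 := fun e => by ring
    simp only [h1, SMul_add_one, Finset.mul_sum, Finset.sum_mul]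
    rw [Finset.sum_sigma', Finset.sum_sigma']
    -- Both sides run over triples of degrees with sum `n`; only the bracketing differs.
    refine Finset.sum_nbij' (fun x => ⟨(x.1.1 + x.2.1, x.2.2), (x.1.1, x.2.1)⟩)
      (fun x => ⟨(x.2.1, x.2.2 + x.1.2), (x.2.2, x.1.2)⟩) ?_ ?_ ?_ ?_ ?_
    · rintro ⟨⟨a, b⟩, c, d⟩ h
      simp only [Finset.mem_sigma, Finset.HasAntidiagonal.mem_antidiagonal] at h ⊢
      obtain ⟨rfl, rfl⟩ := h
      exact ⟨by ring, trivial⟩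
    · rintro ⟨⟨a, b⟩, c, d⟩ h
      simp only [Finset.mem_sigma, Finset.HasAntidiagonal.mem_antidiagonal] at h ⊢
      obtain ⟨rfl, rfl⟩ := h
      exact ⟨by ring, trivial⟩
    · rintro ⟨⟨a, b⟩, c, d⟩ h
      simp only [Finset.mem_sigma, Finset.HasAntidiagonal.mem_antidiagonal] at h
      obtain ⟨rfl, rfl⟩ := h
      rfl
    · rintro ⟨⟨a, b⟩, c, d⟩ h
      simp only [Finset.mem_sigma, Finset.HasAntidiagonal.mem_antidiagonal] at h
      obtain ⟨rfl, rfl⟩ := h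
      rfl
    · rintro ⟨⟨a, b⟩, c, d⟩ h
      simp only [Finset.mem_sigma, Finset.HasAntidiagonal.mem_antidiagonal] at h
      obtain ⟨rfl, rfl⟩ := h
      simp only
      rw [mul_assoc]
      congr 3
      push_cast
      ring

/-- Once lower degrees vanish, only `b = 0` survives in `defect_add_one`, so the defect in degree
`n` is constant in `r`; it vanishes at `r = l` by the cutting identity. -/
theorem defect_eq_zero (k l n : ℕ) (r : ℤ) : defect k l n r = 0 := by
  induction n using Nat.strong_induction_on generalizing r with
  | _ n ih =>
  have hstep : ∀ r, defect k l n (r + 1) = defect k l n r := by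
    intro r
    rw [defect_add_one, Finset.sum_eq_single (n, 0)]
    · simp [S_zero]
    · rintro ⟨a, b⟩ hab hne
      rw [Finset.HasAntidiagonal.mem_antidiagonal] at hab
      simp only at hab
      rw [ih a, zero_mul]
      rw [Ne, Prod.mk.injEq] at hne
      omega
    · exact fun h => absurd (Finset.HasAntidiagonal.mem_antidiagonal.2 (add_zero n)) h
  have hl : defect k l n l = 0 := by
    rw [defect, SMul_eq_sum_parkingSum]
    simp
  have hall : ∀ m : ℤ, defect k l n (l + m) = 0 := by
    intro m
    induction m using Int.induction_on with
    | zero => rwa [add_zero]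
    | succ m ih => rw [← add_assoc, hstep, ih]
    | pred m ih =>
      rw [← hstep, ← ih]
      congr 1
      ring
  rw [← hall (r - l)]
  congr 1
  ring

theorem F_eq_mul (k l : ℕ) (r : ℤ) :
    ((F r k : NSym⟦X⟧ˣ) : NSym⟦X⟧) =
      PowerSeries.mk (parkingSum k l) * ((F (r - l) k : NSym⟦X⟧ˣ) : NSym⟦X⟧) := by
  ext1 n
  have h : ∀ s : ℤ, ((F s k : NSym⟦X⟧ˣ) : NSym⟦X⟧) = PowerSeries.mk fun n => SMul (n * k + s) n :=
    fun s => rfl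
  rw [h, h, coeff_mul]
  simp only [coeff_mk]
  exact sub_eq_zero.1 (defect_eq_zero k l n r)

theorem g_eq (k l : ℕ) (r : ℤ) : g k l r = PowerSeries.mk (parkingSum k l) := by
  rw [g, Units.val_mul, F_eq_mul k l r, Units.mul_inv_cancel_right]

/-! ### Parking functions -/

theorem PF_finite (k l n : ℕ) : (PF k l n).Finite :=
  (Set.Finite.pi' fun _ : Fin n => Set.finite_Icc 1 (l + (n - 1) * k)).subset fun _ hv => hv.1

/-- The alphabet sizes `l + (n - 1)k` and `l + nk` differ harmlessly: the bounds `v i ≤ l + ik` for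
`i < n` imply both. -/
theorem mem_PF_and_monotone_iff {k l : ℕ} {v : Fin n → ℕ} :
    v ∈ PF k l n ∧ Monotone v ↔ v ∈ words n (l + n * k) ∧ ∀ i : Fin n, v i ≤ l + i * k := by
  have hsort : Monotone v → sortWord v = v := fun h => by
    rw [sortWord, Tuple.sort_eq_refl_iff_monotone.2 h]
    rfl
  rw [mem_words]
  constructor
  · rintro ⟨⟨h1, h2⟩, hm⟩
    rw [hsort hm] at h2
    exact ⟨⟨fun i => ⟨(h1 i).1, (h2 i).trans
      (Nat.add_le_add_left (Nat.mul_le_mul_right k i.2.le) l)⟩, hm⟩, h2⟩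
  · rintro ⟨⟨h1, hm⟩, h2⟩
    refine ⟨⟨fun i => ⟨(h1 i).1, (h2 i).trans
      (Nat.add_le_add_left (Nat.mul_le_mul_right k (by omega)) l)⟩, ?_⟩, hm⟩
    rwa [hsort hm]

theorem isCharacteristic_PFModule_iff (k l n : ℕ) (c : NSym) :
    IsCharacteristic n (PFModule k l n) c ↔ c = parkingSum k l n := by
  classical
  rw [isCharacteristic_wordModule_iff (PF_swapStable k l n)
    ((words n (l + n * k)).filter fun u => ∀ i : Fin n, u i ≤ l + i * k) (PF_finite k l n)
    fun v => by rw [mem_PF_and_monotone_iff, Finset.mem_filter]]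
  have : ∀ v ∈ (words n (l + n * k)).filter (fun u => ∀ i : Fin n, u i ≤ l + i * k),
      ∑ J : Composition n with ∀ i, IsDescent J i → letL v i < letR v i, ribbon J =
        wt (l + n * k) v := fun v hv => by
    obtain ⟨h1, hm⟩ := mem_words.1 (Finset.mem_filter.1 hv).1
    exact sum_ribbon_ascents _ h1 hm
  rw [parkingSum, Finset.sum_congr rfl this]

end

end NCParking

end

theorem mainTheorem7 (k l : ℕ) :
    (∀ r s : ℤ, NCParking.g k l r = NCParking.g k l s) ∧
    ∀ (n : ℕ) (r : ℤ),
      Module.Projective (NCParking.HeckeZero n)ᵐᵒᵖ (NCParking.PFModule k l n) ∧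
      ∀ c : NCParking.NSym,
        NCParking.IsCharacteristic n (NCParking.PFModule k l n) c ↔
          c = PowerSeries.coeff n (NCParking.g k l r) := by
  refine ⟨fun r s => by rw [NCParking.g_eq, NCParking.g_eq], fun n r =>
    ⟨NCParking.wordModule_projective _, fun c => ?_⟩⟩
  rw [NCParking.g_eq, PowerSeries.coeff_mk, NCParking.isCharacteristic_PFModule_iff]
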